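/- All logarithms are to base 2, $h(x)=-x\log x-(1-x)\log(1-x)$, and a function of $\ell\in\mathbb N$ is negligible if it tends to $0$ faster than every inverse polynomial in $\ell$. The min-entropy of $X$ is $H_\infty(X)=\min_x(-\log \Pr[X=x])$, a $k$-source is an $X$ with $H_\infty(X)\ge k$, and a $(k,\varepsilon)$-strong extractor is a function $\mathrm{Ext}$ such that for every $k$-source $X$ the pair $(\mathrm{Ext}(X,U_r),U_r)$ has statistical distance at most $\varepsilon$ from $(U_m,U_r)$, where $U_m,U_r$ are independent and uniform on $\{0,1\}^m,\{0,1\}^r$. **Parameters.** Fix constants $0\le\gamma<\alpha<1$, $\delta\ge 0$, $\zeta>0$ with $\delta+\zeta<1/2$, $\tau>0$, $\omega>2h(\delta+\zeta)$ and $\psi>0$. Let $\ell$ be the security parameter, let $n=n(\ell)\in\mathbb N$ be polynomially bounded in $\ell$, and let $\varepsilon'=\varepsilon'(\ell)>0$ and $\varepsilon_E=\varepsilon_E(\ell)$ be negligible in $\ell$. Put $$k=\lfloor 2\sqrt{\ell n}\rfloor,\quad \rho=\alpha-\gamma-\frac{1+\log(1/\varepsilon')}{n},\quad k_E=(\rho-3\tau-\omega)k,\quad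 m=\lfloor(1-\psi)k_E\rfloor,\quad q=\lfloor\omega k\rfloor,$$ where a negative value is replaced by $0$ in the definition of $m$. **Protocol.** Let $G$ be a family of 2-universal hash functions $\{0,1\}^k\to\{0,1\}^q$ (for $x\ne y$, a uniformly random $g\in G$ has $g(x)=g(y)$ with probability at most $2^{-q}$) and $\mathrm{Ext}:\{0,1\}^k\times\{0,1\}^r\to\{0,1\}^m$ a $(k_E,\varepsilon_E)$-strong extractor. Alice has $X\in\{0,1\}^n$ and Bob receives $\tilde X\in\{0,1\}^n$; Bob stores $f(\tilde X)$ and discards $\tilde X$. Alice draws a uniformly random set $A$ of $k$ positions of $X$. In the commit phase Bob sends some $g\in G$; Alice, who commits to a value $V\in\{0,1\}^m$, draws $u\in\{0,1\}^r$ uniformly and sends $(\Omega,\,g(X^A),\,A,\,u)$ with $\Omega=V\oplus \mathrm{Ext}(X^A,u)$. The whole communication is $M=(g,\Omega,g(X^A),A,u)$. **Claim.** There is a function $\lambda_H(\ell)$, negligible in $\ell$ and depending only on the parameters above, such that for every $\ell$ with $k\le n$, $\tau\le\rho/3$ and $\rho-3\tau>\omega$, and for every such $G$, $r$ and $\mathrm{Ext}$,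 the protocol is $\lambda_H(\ell)$-hiding: for every joint distribution of $(X,\tilde X)$ such that $X$ is an $\alpha n$-source and the Hamming distance of $X$ and $\tilde X$ is always at most $\delta n$, every distribution of $V$, and every (possibly malicious, computationally unbounded) Bob, who has randomness $R_B$ (from an arbitrary finite alphabet), stores a string $f(\tilde X)=f(\tilde X,R_B)$ of at most $\gamma n$ bits and chooses $g$ as a function of $f(\tilde X)$ and $R_B$, one has $$I\bigl(V;\,R_B,M \,\big|\, f(\tilde X)\bigr)\le\lambda_H(\ell).$$ Here $(X,\tilde X)$, $V$, $R_B$, $A$ and $u$ are independent. -/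

import Mathlib

namespace BSMCommit

noncomputable section

/-- Bit strings of length `n`. -/
abbrev Bits (n : ℕ) : Type := Fin n → Bool

/-- Bitwise exclusive or. -/
def bxor {m : ℕ} (x y : Bits m) : Bits m := fun i => xor (x i) (y i)

/-- Bit strings of length at most `s`: the possible contents of a memory of `s` bits. -/
abbrev Memory (s : ℕ) : Type := (j : Fin (s + 1)) × Bits j

/-! ### Information measures on finite alphabets (logarithms in base 2) -/

/-- Binary entropy function in bits. -/
def h (x : ℝ) : ℝ := Real.binEntropy x / Real.log 2

/-- Shannon entropy in bits. -/
def entropy {α : Type} [Fintype α] (p : PMF α) : ℝ :=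
  (∑ a, Real.negMulLog (p a).toReal) / Real.log 2

/-- Conditional mutual information `I(A ; B | C)` in bits of a triple `(A, B, C)` with joint
distribution `p`, that is `H(A, C) + H(B, C) - H(A, B, C) - H(C)`. -/
def condMutualInfo {α β γ : Type} [Fintype α] [Fintype β] [Fintype γ]
    (p : PMF (α × β × γ)) : ℝ :=
  entropy (p.map fun t => (t.1, t.2.2)) + entropy (p.map fun t => t.2)
    - entropy p - entropy (p.map fun t => t.2.2)

/-- Min-entropy in bits, `min_x (-log p(x)) = -log (max_x p(x))`. -/
def minEntropy {α : Type} [Fintype α] (p : PMF α) : ℝ :=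
  -Real.logb 2 (⨆ a, (p a).toReal)

/-- A `k`-source is a distribution of min-entropy at least `k`. -/
def IsSource {α : Type} [Fintype α] (p : PMF α) (k : ℝ) : Prop := k ≤ minEntropy p

/-- Statistical distance, the maximum over all events of the difference of probabilities. -/
def statDist {α : Type} [Fintype α] (p q : PMF α) : ℝ :=
  ⨆ S : Finset α, |∑ a ∈ S, ((p a).toReal - (q a).toReal)|

/-! ### The tools used by the protocol -/

/-- `Ext : {0,1}^k × {0,1}^r → {0,1}^m` is a `(kE, ε)`-strong extractor: for every `kE`-source `X`,
`(Ext(X, U_r), U_r)` is `ε`-close to `(U_m, U_r)`. -/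
def IsStrongExtractor {k r m : ℕ} (Ext : Bits k → Bits r → Bits m) (kE ε : ℝ) : Prop :=
  ∀ X : PMF (Bits k), IsSource X kE →
    statDist (X.bind fun x => (PMF.uniformOfFintype (Bits r)).map fun u => (Ext x u, u))
      (PMF.uniformOfFintype (Bits m × Bits r)) ≤ ε

/-- A family of 2-universal hash functions from `k` to `q` bits, indexed by `κ`. -/
def IsTwoUniversal {κ : Type} [Fintype κ] {k q : ℕ} (G : κ → Bits k → Bits q) : Prop :=
  ∀ x y : Bits k, x ≠ y →
    (Fintype.card {i : κ // G i x = G i y} : ℝ) / (Fintype.card κ : ℝ)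
      ≤ 1 / (Fintype.card (Bits q) : ℝ)

/-- A function is negligible if it decays faster than every inverse polynomial. -/
def Negligible (f : ℕ → ℝ) : Prop :=
  Asymptotics.SuperpolynomialDecay Filter.atTop (fun l : ℕ => (l : ℝ)) f

/-- The sets of `k` positions in a string of length `n`. -/
abbrev Positions (n k : ℕ) : Type := {A : Finset (Fin n) // A.card = k}

theorem positions_nonempty {n k : ℕ} (hk : k ≤ n) : Nonempty (Positions n k) := by
  obtain ⟨A, _, hA⟩ := Finset.exists_subset_card_eq
    (s := (Finset.univ : Finset (Fin n))) (n := k) (by simpa using hk)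
  exact ⟨⟨A, hA⟩⟩

/-- A uniformly random set of `k` positions. -/
def uniformPositions {n k : ℕ} (hk : k ≤ n) : PMF (Positions n k) :=
  haveI := positions_nonempty hk
  PMF.uniformOfFintype (Positions n k)

/-- The restriction `x^A` of `x` to the positions in `A`, in increasing order. -/
def restrict {n k : ℕ} (x : Bits n) (A : Positions n k) : Bits k :=
  fun i => x (A.1.orderEmbOfFin A.2 i)

/-! ### The parameters -/

/-- The sample size `k = 2 √(ℓ n)` (rounded down). -/
def sampleSize (l n : ℕ) : ℕ := ⌊2 * Real.sqrt ((l : ℝ) * n)⌋₊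

/-- The rate `ρ = α - γ - (1 + log (1/ε')) / n`. -/
def rate (α γ ε' : ℝ) (n : ℕ) : ℝ := α - γ - (1 + Real.logb 2 (1 / ε')) / n

/-- The entropy threshold `kE = (ρ - 3 τ - ω) k` of the extractor. -/
def extThreshold (ρ τ ω : ℝ) (k : ℕ) : ℝ := (ρ - 3 * τ - ω) * k

/-- The length `(1 - ψ) kE` (rounded down) of the committed string. -/
def msgLength (ψ kE : ℝ) : ℕ := ⌊(1 - ψ) * kE⌋₊

/-- The length `ω k` (rounded down) of the hash value. -/
def hashLength (ω : ℝ) (k : ℕ) : ℕ := ⌊ω * k⌋₊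

/-! ### The transmission and commit phases with an honest Alice -/

/-- The communication `(g, Ω, h, A, u)` of the commit phase: Bob's choice of a hash function, then
Alice's concealed value, hash value, set of positions and extractor seed. -/
abbrev Transcript (κ : Type) (n k q m r : ℕ) : Type :=
  κ × Bits m × Bits q × Positions n k × Bits r

/-- A possibly malicious Bob with randomness of type `R` and a memory of `s` bits: what he stores
of the string that he received, and the hash function that he then asks for, which depends on
the received string only through the memory. -/
structure Bob (κ : Type) (n s : ℕ) (R : Type) where
  /-- The distribution of Bob's randomness. -/
  coins : PMF R
  /-- The memory content computed from the received string. -/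
  store : Bits n → R → Memory s
  /-- The hash function sent to Alice. -/
  query : Memory s → R → κ

/-- The message of an honest Alice with source string `x`, value `v`, positions `A` and seed `u`,
in reply to `g`, together with `g`. -/
def transcript {κ : Type} {n k q m r : ℕ} (G : κ → Bits k → Bits q)
    (Ext : Bits k → Bits r → Bits m) (x : Bits n) (v : Bits m) (A : Positions n k) (u : Bits r)
    (g : κ) : Transcript κ n k q m r :=
  (g, bxor v (Ext (restrict x A) u), G g (restrict x A), A, u)

/-- The joint distribution of `(V, (R_B, M), f(X̃))` after the commit phase. The pair `(X, X̃)`, the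
value `V`, Bob's randomness `R_B`, Alice's positions and her seed are independent. -/
def execution {κ R : Type} {n k q m r s : ℕ} (hk : k ≤ n) (G : κ → Bits k → Bits q)
    (Ext : Bits k → Bits r → Bits m) (source : PMF (Bits n × Bits n)) (V : PMF (Bits m))
    (B : Bob κ n s R) : PMF (Bits m × (R × Transcript κ n k q m r) × Memory s) :=
  source.bind fun x =>
  V.bind fun v =>
  B.coins.bind fun b =>
  (uniformPositions hk).bind fun A =>
  (PMF.uniformOfFintype (Bits r)).map fun u =>
    (v, (b, transcript G Ext x.1 v A u (B.query (B.store x.2 b) b)), B.store x.2 b)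

/-- The protocol is `lam`-hiding: `I(V ; R_B, M | f(X̃)) ≤ lam` for every joint distribution of
`(X, X̃)` such that `X` is an `α n`-source and `HD(X, X̃) ≤ δ n`, every distribution of `V`, and
every Bob who stores at most `γ n` bits. -/
def IsHiding {κ : Type} [Fintype κ] {n k q m r : ℕ} (hk : k ≤ n) (G : κ → Bits k → Bits q)
    (Ext : Bits k → Bits r → Bits m) (α γ δ lam : ℝ) : Prop :=
  ∀ source : PMF (Bits n × Bits n),
    IsSource (source.map Prod.fst) (α * n) →
    (∀ x ∈ source.support, (hammingDist x.1 x.2 : ℝ) ≤ δ * n) →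
  ∀ V : PMF (Bits m),
  ∀ (R : Type) [Fintype R] (s : ℕ) (B : Bob κ n s R), (s : ℝ) ≤ γ * n →
    condMutualInfo (execution hk G Ext source V B) ≤ lam

end

end BSMCommit

/-! The value `V` is a one-time pad on the extracted string, so the leaked information is exactly an
entropy difference: the entropy of Bob's view and memory with the mask, minus the same entropy
without it (`condMutualInfo_mask_le`). Permuting the pad coordinate can raise the entropy only as
far as the unmasked pad is from uniform given the rest. This bounds the leak by a multiple of `m`
times an L1 deviation, and the deviation is what has to be made negligible.

To bound it, fix Bob's coins `b` and a memory content `f`. No conditioning is performed: the strings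
leading to `f` carry an unnormalised weight `w`, pointwise at most `2 ^ (-α n)`. If the total weight
of `w` is at most `2 ^ ((ρ - α) n)`, the trivial bound is used; summed over the fewer than `2 ^ (s +
1)` memories, these cases cost a multiple of `ε'`. Otherwise `w`, once normalised, has min-entropy
rate at least `ρ`. A random sample then keeps rate `ρ - 2 τ` outside a rare event
(`exists_sampling_bound`), the hash value costs at most `q` bits, and the extractor applies with
slack `τ k` (`exists_sum_extError_bound`).

The sampling bound rests on the chain rule. Each bit is given the cost `-log` of its conditional
probability given the preceding bits, truncated so as to be bounded. The total cost is nearly the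
min-entropy except on a set of tiny mass, and a random sample of positions catches its share of the
total by a Chernoff bound without replacement, for which Maclaurin's inequality replaces
independence. The unsampled factors sum to at most `1` over each fibre, so a high sampled cost
bounds the mass of the sampled string. -/

namespace BSMCommit

/-! ### Symmetric sums and tails of sampling without replacement. -/

/-- Elementary symmetric sum of degree `k` of the values of `a` on `s`. -/
def esymmOn {ι : Type} (a : ι → ℝ) (s : Finset ι) (k : ℕ) : ℝ :=
  ∑ B ∈ s.powersetCard k, ∏ i ∈ B, a i

theorem esymmOn_nonneg {ι : Type} {a : ι → ℝ} (ha : ∀ i, 0 ≤ a i) (s : Finset ι) (k : ℕ) :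
    0 ≤ esymmOn a s k :=
  Finset.sum_nonneg fun _ _ => Finset.prod_nonneg fun i _ => ha i

theorem esymmOn_succ {ι : Type} [DecidableEq ι] (a : ι → ℝ) {s : Finset ι} {j : ι} (hj : j ∈ s)
    (k : ℕ) :
    esymmOn a s (k + 1) = esymmOn a (s.erase j) (k + 1) + a j * esymmOn a (s.erase j) k := by
  unfold esymmOn
  have hj' := Finset.notMem_erase j s
  conv_lhs => rw [← Finset.insert_erase hj, Finset.powersetCard_succ_insert hj']
  have hmem : ∀ B ∈ (s.erase j).powersetCard k, j ∉ B := fun B hB h =>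
    hj' ((Finset.mem_powersetCard.1 hB).1 h)
  rw [Finset.sum_union, Finset.sum_image, Finset.mul_sum]
  · congr 1
    exact Finset.sum_congr rfl fun B hB => Finset.prod_insert (hmem B hB)
  · intro B hB C hC h
    rw [← Finset.erase_insert (hmem B hB), ← Finset.erase_insert (hmem C hC)]
    exact congrArg (fun D => Finset.erase D j) h
  · rw [Finset.disjoint_left]
    intro B hB hB'
    obtain ⟨C, _, rfl⟩ := Finset.mem_image.1 hB'
    exact hj' ((Finset.mem_powersetCard.1 hB).1 (Finset.mem_insert_self j C))

/-- Double counting: a `k`-subset survives the removal of `i` for exactly the `s.card - k` elements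
`i` outside it. -/
theorem sum_esymmOn_erase {ι : Type} [DecidableEq ι] (a : ι → ℝ) (s : Finset ι) (k : ℕ) :
    ∑ i ∈ s, esymmOn a (s.erase i) k = ((s.card : ℝ) - k) * esymmOn a s k := by
  unfold esymmOn
  have h1 : ∀ i ∈ s, ∑ B ∈ (s.erase i).powersetCard k, ∏ l ∈ B, a l
      = ∑ B ∈ s.powersetCard k, if i ∉ B then ∏ l ∈ B, a l else 0 := by
    intro i _
    rw [← Finset.sum_filter]
    refine Finset.sum_congr ?_ fun _ _ => rfl
    ext B
    simp only [Finset.mem_powersetCard, Finset.mem_filter, Finset.subset_erase]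
    tauto
  rw [Finset.sum_congr rfl h1, Finset.sum_comm, Finset.mul_sum]
  refine Finset.sum_congr rfl fun B hB => ?_
  obtain ⟨hBs, hBk⟩ := Finset.mem_powersetCard.1 hB
  rw [← Finset.sum_filter, Finset.sum_const, nsmul_eq_mul, Finset.filter_notMem_eq_sdiff,
    Finset.card_sdiff_of_subset hBs, Nat.cast_sub (Finset.card_le_card hBs), hBk]

/-- Splitting off the other of the two elements leaves the same symmetric sums over `s` without `i`
and `j`, weighted by `a i` on one side and `a j` on the other. -/
theorem esymmOn_erase_antitone {ι : Type} [DecidableEq ι] {a : ι → ℝ} (ha : ∀ i, 0 ≤ a i)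
    {s : Finset ι} {i j : ι} (hi : i ∈ s) (hj : j ∈ s) (hij : a i ≤ a j) (k : ℕ) :
    esymmOn a (s.erase j) k ≤ esymmOn a (s.erase i) k := by
  rcases eq_or_ne i j with rfl | hne
  · rfl
  cases k with
  | zero => simp [esymmOn]
  | succ k =>
    rw [esymmOn_succ a (Finset.mem_erase.2 ⟨hne, hi⟩), esymmOn_succ a
      (Finset.mem_erase.2 ⟨hne.symm, hj⟩), Finset.erase_right_comm]
    gcongr
    exact esymmOn_nonneg ha _ _

/-- Chebyshev's sum inequality: `a i` and the symmetric sum without `i` are oppositely ordered, and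
their products add up to `(k + 1)` times the next symmetric sum. -/
theorem card_mul_esymmOn_succ_le {ι : Type} [DecidableEq ι] {a : ι → ℝ} (ha : ∀ i, 0 ≤ a i)
    (s : Finset ι) (k : ℕ) :
    (s.card : ℝ) * ((k + 1 : ℝ) * esymmOn a s (k + 1))
      ≤ (∑ i ∈ s, a i) * (((s.card : ℝ) - k) * esymmOn a s k) := by
  have hanti : AntivaryOn a (fun i => esymmOn a (s.erase i) k) s := by
    intro i hi j hj hlt
    by_contra! h
    exact absurd (esymmOn_erase_antitone ha hi hj h.le k) (not_le.2 hlt)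
  have hcheb := hanti.card_mul_sum_le_sum_mul_sum
  rw [sum_esymmOn_erase] at hcheb
  refine le_of_eq_of_le ?_ hcheb
  congr 1
  have h1 : ∀ i ∈ s, a i * esymmOn a (s.erase i) k
      = esymmOn a s (k + 1) - esymmOn a (s.erase i) (k + 1) := by
    intro i hi
    rw [esymmOn_succ a hi]; ring
  rw [Finset.sum_congr rfl h1, Finset.sum_sub_distrib, sum_esymmOn_erase, Finset.sum_const,
    nsmul_eq_mul]
  push_cast
  ring

/-- A weak form of Maclaurin's inequality. -/
theorem esymmOn_le {ι : Type} [DecidableEq ι] {a : ι → ℝ} (ha : ∀ i, 0 ≤ a i)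
    {s : Finset ι} (hs : s.Nonempty) (k : ℕ) :
    esymmOn a s k ≤ (s.card.choose k : ℝ) * ((∑ i ∈ s, a i) / s.card) ^ k := by
  have hc : (0 : ℝ) < s.card := by exact_mod_cast hs.card_pos
  have hsum : 0 ≤ ∑ i ∈ s, a i := Finset.sum_nonneg fun i _ => ha i
  induction k with
  | zero => simp [esymmOn]
  | succ k ih =>
    rcases lt_or_ge s.card (k + 1) with hlt | hge
    · rw [esymmOn, Finset.powersetCard_eq_empty.2 hlt]
      simp only [Finset.sum_empty]
      positivity
    have hk : (0 : ℝ) ≤ (s.card : ℝ) - k := by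
      have : ((k + 1 : ℕ) : ℝ) ≤ s.card := by exact_mod_cast hge
      push_cast at this; linarith
    have h1 := card_mul_esymmOn_succ_le ha s k
    have h2 : (s.card.choose (k + 1) : ℝ) * (k + 1) = s.card.choose k * ((s.card : ℝ) - k) := by
      have := Nat.choose_succ_right_eq s.card k
      rw [← Nat.cast_sub (by omega)]
      exact_mod_cast this
    have h3 : (s.card : ℝ) * ((k + 1 : ℝ) * esymmOn a s (k + 1)) ≤ (s.card : ℝ) * ((k + 1 : ℝ) *
        (s.card.choose (k + 1) * ((∑ i ∈ s, a i) / s.card) ^ (k + 1))) := by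
      calc _ ≤ _ := h1
        _ ≤ (∑ i ∈ s, a i) * (((s.card : ℝ) - k) *
            (s.card.choose k * ((∑ i ∈ s, a i) / s.card) ^ k)) := by gcongr
        _ = (∑ i ∈ s, a i) * ((s.card.choose (k + 1) * (k + 1)) *
            ((∑ i ∈ s, a i) / s.card) ^ k) := by rw [h2]; ring
        _ = _ := by rw [pow_succ]; field_simp
    have hk1 : (0 : ℝ) < k + 1 := by positivity
    exact le_of_mul_le_mul_left (le_of_mul_le_mul_left h3 hc) hk1

/-- `(1 - v + v²/2)(1 + v + v²/2) = 1 + v⁴/4 ≥ 1`, and the second factor is at most `exp v`. -/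
theorem exp_neg_le_quadratic {v : ℝ} (hv : 0 ≤ v) : Real.exp (-v) ≤ 1 - v + v ^ 2 / 2 := by
  have h1 := Real.quadratic_le_exp_of_nonneg hv
  have h2 : 0 ≤ 1 - v + v ^ 2 / 2 := by nlinarith [sq_nonneg (v - 1)]
  have h3 : Real.exp (-v) * Real.exp v = 1 := by rw [← Real.exp_add]; simp
  have h4 : 1 ≤ (1 - v + v ^ 2 / 2) * Real.exp v := by
    calc (1 : ℝ) ≤ (1 - v + v ^ 2 / 2) * (1 + v + v ^ 2 / 2) := by nlinarith [sq_nonneg (v ^ 2)]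
      _ ≤ _ := by gcongr
  have h5 := Real.exp_pos v
  nlinarith

theorem card_positions (n k : ℕ) : Fintype.card (Positions n k) = n.choose k := by
  rw [Fintype.card_finset_len, Fintype.card_fin]

theorem sum_positions {n k : ℕ} (f : Finset (Fin n) → ℝ) :
    ∑ A : Positions n k, f A.1 = ∑ A ∈ Finset.powersetCard k Finset.univ, f A :=
  (Finset.sum_subtype _ (fun A => by simp [Finset.mem_powersetCard]) f).symm

open Classical in
/-- Lower tail bound for sums sampled without replacement. -/
theorem card_positions_sum_lt_le {n k : ℕ} (hn : 0 < n) {v : Fin n → ℝ} {L a d : ℝ} (hL : 0 < L)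
    (hd : 0 ≤ d) (hv : ∀ i, 0 ≤ v i) (hvL : ∀ i, v i ≤ L) (ha : a * n ≤ ∑ i, v i) :
    ((Finset.univ.filter fun A : Positions n k => ∑ i ∈ A.1, v i < (a - d) * k).card : ℝ)
      ≤ Fintype.card (Positions n k) * Real.exp (-(d ^ 2 / (2 * L ^ 2)) * k) := by
  have hn' : (0 : ℝ) < n := by exact_mod_cast hn
  have : Nonempty (Fin n) := ⟨⟨0, hn⟩⟩
  -- The Chernoff parameter minimising `-s d + s² L² / 2`, with minimum `-d² / (2 L²)`.
  set s := d / L ^ 2 with hs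
  have hs0 : 0 ≤ s := by positivity
  have hmean : (∑ i, Real.exp (-(s * v i))) / n ≤ Real.exp (-(s * a) + s ^ 2 * L ^ 2 / 2) := by
    have h1 : ∑ i, Real.exp (-(s * v i)) ≤ ∑ i, (1 - s * v i + s ^ 2 * L ^ 2 / 2) := by
      refine Finset.sum_le_sum fun i _ => ?_
      have h2 := exp_neg_le_quadratic (mul_nonneg hs0 (hv i))
      have h3 : (s * v i) ^ 2 ≤ s ^ 2 * L ^ 2 := by
        rw [mul_pow]
        have := hv i; have := hvL i
        gcongr
      linarith
    rw [Finset.sum_add_distrib, Finset.sum_sub_distrib, ← Finset.mul_sum] at h1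
    simp only [Finset.sum_const, Finset.card_univ, Fintype.card_fin, nsmul_eq_mul, mul_one] at h1
    have h4 : s * (a * n) ≤ s * ∑ i, v i := by gcongr
    have h5 := Real.add_one_le_exp (-(s * a) + s ^ 2 * L ^ 2 / 2)
    rw [div_le_iff₀ hn']
    nlinarith
  have hmac := esymmOn_le (a := fun i => Real.exp (-(s * v i))) (fun i => (Real.exp_pos _).le)
    (Finset.univ_nonempty (α := Fin n)) k
  simp only [Finset.card_univ, Fintype.card_fin] at hmac
  have hmarkov : ((Finset.univ.filter fun A : Positions n k =>
      ∑ i ∈ A.1, v i < (a - d) * k).card : ℝ)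
      ≤ Real.exp (s * ((a - d) * k)) * esymmOn (fun i => Real.exp (-(s * v i))) Finset.univ k := by
    rw [esymmOn, ← sum_positions, Finset.mul_sum, ← Finset.sum_boole]
    refine Finset.sum_le_sum fun A _ => ?_
    rw [← Real.exp_sum, ← Real.exp_add, Finset.sum_neg_distrib, ← Finset.mul_sum]
    split_ifs with h
    · apply Real.one_le_exp
      have : s * ∑ i ∈ A.1, v i ≤ s * ((a - d) * k) := by gcongr
      linarith
    · positivity
  calc _ ≤ _ := hmarkov
    _ ≤ Real.exp (s * ((a - d) * k)) * ((n.choose k : ℝ) *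
        (Real.exp (-(s * a) + s ^ 2 * L ^ 2 / 2)) ^ k) := by
      gcongr
      refine hmac.trans ?_
      gcongr
    _ = _ := by
      rw [card_positions, ← Real.exp_nat_mul, mul_left_comm, ← Real.exp_add]
      congr 2
      rw [hs]
      field_simp
      ring

/-! ### Chain rule for distributions on bit strings. -/

open Function in
/-- A product of sub-stochastic sequential kernels, up to a factor `C` per position, has total mass
at most `C ^ n`. -/
theorem sum_prod_kernel_le {C : ℝ} (hC : 0 ≤ C) (n : ℕ) (K : Fin n → Bits n → ℝ)
    (hK0 : ∀ i x, 0 ≤ K i x)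
    (hKdep : ∀ i x y, (∀ j, j ≤ i → x j = y j) → K i x = K i y)
    (hKsum : ∀ i x, K i (update x i true) + K i (update x i false) ≤ C) :
    ∑ x : Bits n, ∏ i, K i x ≤ C ^ n := by
  induction n with
  | zero => simp
  | succ n ih =>
    have hsum : ∑ x : Bits (n + 1), ∏ i, K i x
        = ∑ y : Bits n, ((∏ i : Fin n, K i.castSucc (Fin.snoc y false : Bits (n + 1))) *
          (K (Fin.last n) (Fin.snoc y true : Bits (n + 1))
            + K (Fin.last n) (Fin.snoc y false : Bits (n + 1)))) := by
      rw [← (Fin.snocEquiv fun _ => Bool).sum_comp, Fintype.sum_prod_type, Finset.sum_comm]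
      refine Finset.sum_congr rfl fun y _ => ?_
      rw [Fintype.sum_bool]
      change (∏ i, K i (Fin.snoc y true : Bits (n + 1)))
        + ∏ i, K i (Fin.snoc y false : Bits (n + 1)) = _
      rw [Fin.prod_univ_castSucc, Fin.prod_univ_castSucc, mul_add]
      congr 2
      -- The earlier kernels do not see the last bit, so summing over it affects only the last
      -- kernel.
      refine Finset.prod_congr rfl fun i _ => hKdep _ _ _ fun j hj => ?_
      obtain ⟨j', rfl⟩ : ∃ j' : Fin n, j = j'.castSucc :=
        ⟨j.castLT (lt_of_le_of_lt hj i.2), by simp⟩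
      simp
    have hlast : ∀ y : Bits n, K (Fin.last n) (Fin.snoc y true : Bits (n + 1))
        + K (Fin.last n) (Fin.snoc y false : Bits (n + 1)) ≤ C := fun y => by
      simpa [Fin.update_snoc_last] using hKsum (Fin.last n) (Fin.snoc y false : Bits (n + 1))
    rw [hsum, pow_succ]
    calc _ ≤ ∑ y : Bits n, (∏ i : Fin n, K i.castSucc (Fin.snoc y false : Bits (n + 1))) * C := by
          refine Finset.sum_le_sum fun y _ => ?_
          gcongr
          · exact Finset.prod_nonneg fun i _ => hK0 _ _
          · exact hlast y
      _ = (∑ y : Bits n, ∏ i : Fin n, K i.castSucc (Fin.snoc y false : Bits (n + 1))) * C := by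
          rw [Finset.sum_mul]
      _ ≤ C ^ n * C := by
          gcongr
          refine ih _ (fun i y => hK0 _ _) (fun i y z h => hKdep _ _ _ fun j hj => ?_)
            fun i y => ?_
          · obtain ⟨j', rfl⟩ : ∃ j' : Fin n, j = j'.castSucc :=
              ⟨j.castLT (lt_of_le_of_lt hj i.2), by simp⟩
            simpa using h j' (by simpa using hj)
          · simpa [Fin.snoc_update] using hKsum i.castSucc (Fin.snoc y false : Bits (n + 1))

/-- The mass of the strings that agree with `x` on the first `i` positions. -/
def prefixMass {n : ℕ} (P : Bits n → ℝ) (i : ℕ) (x : Bits n) : ℝ :=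
  ∑ y : Bits n, if ∀ j : Fin n, j.1 < i → y j = x j then P y else 0

/-- The conditional probability of bit `i` of `x` given the preceding bits. -/
noncomputable def condProb {n : ℕ} (P : Bits n → ℝ) (i : Fin n) (x : Bits n) : ℝ :=
  prefixMass P (i + 1) x / prefixMass P i x

theorem prefixMass_nonneg {n : ℕ} {P : Bits n → ℝ} (hP : ∀ x, 0 ≤ P x) (i : ℕ) (x : Bits n) :
    0 ≤ prefixMass P i x :=
  Finset.sum_nonneg fun y _ => by split_ifs <;> simp [hP]

theorem prefixMass_congr {n : ℕ} (P : Bits n → ℝ) {i : ℕ} {x y : Bits n}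
    (h : ∀ j : Fin n, j.1 < i → x j = y j) : prefixMass P i x = prefixMass P i y := by
  unfold prefixMass
  refine Finset.sum_congr rfl fun z _ => ?_
  congr 1
  exact propext (forall₂_congr fun j hj => by rw [h j hj])

theorem prefixMass_anti {n : ℕ} {P : Bits n → ℝ} (hP : ∀ x, 0 ≤ P x) {i j : ℕ} (hij : i ≤ j)
    (x : Bits n) : prefixMass P j x ≤ prefixMass P i x := by
  refine Finset.sum_le_sum fun y _ => ?_
  by_cases h : ∀ l : Fin n, l.1 < j → y l = x l
  · rw [if_pos h, if_pos fun l hl => h l (hl.trans_le hij)]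
  · rw [if_neg h]; split_ifs <;> simp [hP]

theorem prefixMass_self {n : ℕ} (P : Bits n → ℝ) (x : Bits n) : prefixMass P n x = P x := by
  unfold prefixMass
  rw [Finset.sum_eq_single x]
  · simp
  · intro y _ hy
    rw [if_neg]
    exact fun h => hy (funext fun j => h j j.2)
  · simp

theorem prefixMass_zero {n : ℕ} (P : Bits n → ℝ) (x : Bits n) :
    prefixMass P 0 x = ∑ y, P y := by
  simp [prefixMass]

theorem prefixMass_update_add {n : ℕ} (P : Bits n → ℝ) (i : Fin n) (x : Bits n) :
    prefixMass P (i + 1) (Function.update x i true)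
      + prefixMass P (i + 1) (Function.update x i false) = prefixMass P i x := by
  unfold prefixMass
  rw [← Finset.sum_add_distrib]
  refine Finset.sum_congr rfl fun y _ => ?_
  have key : ∀ b : Bool, (∀ j : Fin n, j.1 < i.1 + 1 → y j = Function.update x i b j) ↔
      (∀ j : Fin n, j.1 < i.1 → y j = x j) ∧ y i = b := by
    intro b
    constructor
    · refine fun h => ⟨fun j hj => ?_, by simpa using h i (Nat.lt_succ_self _)⟩
      have hne : j ≠ i := fun h' => by simp [h'] at hj
      simpa [hne] using h j (by omega)
    · rintro ⟨h, hb⟩ j hj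
      rcases eq_or_ne j i with rfl | hne
      · simpa using hb
      · have : j.1 ≠ i.1 := fun h' => hne (Fin.ext h')
        simpa [hne] using h j (by omega)
  simp only [key]
  by_cases h : ∀ j : Fin n, j.1 < i.1 → y j = x j <;> cases y i <;> simp

theorem condProb_nonneg {n : ℕ} {P : Bits n → ℝ} (hP : ∀ x, 0 ≤ P x) (i : Fin n) (x : Bits n) :
    0 ≤ condProb P i x :=
  div_nonneg (prefixMass_nonneg hP _ _) (prefixMass_nonneg hP _ _)

theorem condProb_le_one {n : ℕ} {P : Bits n → ℝ} (hP : ∀ x, 0 ≤ P x) (i : Fin n) (x : Bits n) :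
    condProb P i x ≤ 1 :=
  div_le_one_of_le₀ (prefixMass_anti hP (Nat.le_succ _) _) (prefixMass_nonneg hP _ _)

theorem condProb_congr {n : ℕ} (P : Bits n → ℝ) (i : Fin n) {x y : Bits n}
    (h : ∀ j, j ≤ i → x j = y j) : condProb P i x = condProb P i y := by
  unfold condProb
  rw [prefixMass_congr P fun j hj => h j (Fin.le_def.2 (by omega)),
    prefixMass_congr P (i := i) fun j hj => h j (Fin.le_def.2 hj.le)]

theorem condProb_update_add {n : ℕ} (P : Bits n → ℝ) (i : Fin n) (x : Bits n) :
    condProb P i (Function.update x i true) + condProb P i (Function.update x i false) ≤ 1 := by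
  have h : ∀ b, prefixMass P i (Function.update x i b) = prefixMass P i x := fun b =>
    prefixMass_congr P fun j hj => by
      have hne : j ≠ i := fun h' => by simp [h'] at hj
      simp [hne]
  unfold condProb
  rw [h, h, ← add_div, prefixMass_update_add]
  -- Only an inequality: on a prefix of mass zero both quotients are `0`.
  exact div_self_le_one _

/-- The product telescopes to `P x` where `P x` is positive; elsewhere only nonnegativity is needed.
-/
theorem le_prod_condProb {n : ℕ} {P : Bits n → ℝ} (hP : ∀ x, 0 ≤ P x) (hsum : ∑ x, P x = 1)
    (x : Bits n) : P x ≤ ∏ i, condProb P i x := by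
  rcases (hP x).eq_or_lt with h0 | hpos
  · rw [← h0]; exact Finset.prod_nonneg fun i _ => condProb_nonneg hP i x
  have hne : ∀ i ≤ n, prefixMass P i x ≠ 0 := fun i hi => by
    have := prefixMass_anti hP hi x
    rw [prefixMass_self] at this
    exact (hpos.trans_le this).ne'
  have key : ∀ m (hm : m ≤ n), ∏ i ∈ Finset.range m, prefixMass P (i + 1) x / prefixMass P i x
      = prefixMass P m x := by
    intro m
    induction m with
    | zero => intro _; rw [prefixMass_zero, hsum]; simp
    | succ m ih =>
      intro hm
      rw [Finset.prod_range_succ, ih (by omega), mul_div_cancel₀ _ (hne m (by omega))]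
  refine le_of_eq ?_
  rw [← prefixMass_self P x, ← key n le_rfl, Finset.prod_range]
  rfl

theorem restrict_eq_iff {n k : ℕ} {x y : Bits n} {A : Positions n k} :
    restrict x A = restrict y A ↔ ∀ i ∈ A.1, x i = y i := by
  constructor
  · intro h i hi
    have : i ∈ Set.range (A.1.orderEmbOfFin A.2) := by simpa using hi
    obtain ⟨j, rfl⟩ := this
    exact congrFun h j
  · exact fun h => funext fun j => h _ (Finset.orderEmbOfFin_mem _ _ _)

/-- Fixing the bits in `A`, the conditional probabilities of the other bits have mass at most `1`. -/
theorem sum_restrict_prod_condProb_le {n k : ℕ} {P : Bits n → ℝ} (hP : ∀ x, 0 ≤ P x)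
    (A : Positions n k) (y : Bits k) :
    ∑ x : Bits n, (if restrict x A = y then ∏ i ∈ A.1ᶜ, condProb P i x else 0) ≤ 1 := by
  by_cases hex : ∃ x₀ : Bits n, restrict x₀ A = y
  · obtain ⟨x₀, rfl⟩ := hex
    -- On `A` the kernel is the indicator of the prescribed bit, off `A` the conditional
    -- probability; each step has mass at most `1`.
    have := sum_prod_kernel_le zero_le_one n
      (fun i x => if i ∈ A.1 then (if x i = x₀ i then 1 else 0) else condProb P i x) ?_ ?_ ?_
    · rw [one_pow] at this
      refine le_trans (Finset.sum_le_sum fun x _ => ?_) this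
      split_ifs with h
      · rw [restrict_eq_iff] at h
        rw [← Finset.prod_mul_prod_compl A.1]
        rw [Finset.prod_congr rfl fun i hi => if_pos hi,
          Finset.prod_congr rfl fun i hi => if_pos (h i hi)]
        rw [Finset.prod_congr (s₁ := A.1ᶜ) rfl fun i hi => if_neg (Finset.mem_compl.1 hi)]
        simp
      · refine Finset.prod_nonneg fun i _ => ?_
        have := condProb_nonneg hP i x
        split_ifs <;> simp [this]
    · intro i x
      have := condProb_nonneg hP i x
      split_ifs <;> simp [this]
    · intro i x z h
      rw [h i le_rfl, condProb_congr P i h]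
    · intro i x
      have := condProb_update_add P i x
      by_cases hi : i ∈ A.1
      · simp only [hi, if_true, Function.update_self]
        cases x₀ i <;> simp
      · simpa [hi] using this
  · refine le_trans (le_of_eq (Finset.sum_eq_zero fun x _ => ?_)) zero_le_one
    rw [if_neg fun h => hex ⟨x, h⟩]

/-! ### Truncated costs and min-entropy of a random sample. -/

/-- The cost `-log` of a conditional probability, truncated from below at `t`. -/
noncomputable def truncCost {n : ℕ} (P : Bits n → ℝ) (t : ℝ) (i : Fin n) (x : Bits n) : ℝ :=
  -Real.log (max (condProb P i x) t)

theorem exp_neg_truncCost {n : ℕ} (P : Bits n → ℝ) {t : ℝ} (ht : 0 < t) (i : Fin n) (x : Bits n) :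
    Real.exp (-truncCost P t i x) = max (condProb P i x) t := by
  rw [truncCost, neg_neg, Real.exp_log (lt_max_of_lt_right ht)]

/-- By the chain rule `P x` is at most a product over `A`, bounded by `exp (-T)` through the cost,
times a product over the complement, which has mass at most `1` on the fibre. -/
theorem sum_restrict_le_of_truncCost {n k : ℕ} {P : Bits n → ℝ} (hP : ∀ x, 0 ≤ P x)
    (hsum : ∑ x, P x = 1) {t : ℝ} (ht : 0 < t) (T : ℝ) (A : Positions n k) (y : Bits k) :
    ∑ x : Bits n, (if restrict x A = y ∧ T ≤ ∑ i ∈ A.1, truncCost P t i x then P x else 0)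
      ≤ Real.exp (-T) := by
  calc _ ≤ ∑ x : Bits n, Real.exp (-T) *
        (if restrict x A = y then ∏ i ∈ A.1ᶜ, condProb P i x else 0) := by
        refine Finset.sum_le_sum fun x _ => ?_
        have hprod : 0 ≤ ∏ i ∈ A.1ᶜ, condProb P i x :=
          Finset.prod_nonneg fun i _ => condProb_nonneg hP i x
        by_cases h1 : restrict x A = y
        · by_cases h2 : T ≤ ∑ i ∈ A.1, truncCost P t i x
          · rw [if_pos ⟨h1, h2⟩, if_pos h1]
            refine (le_prod_condProb hP hsum x).trans ?_
            rw [← Finset.prod_mul_prod_compl A.1]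
            gcongr
            calc ∏ i ∈ A.1, condProb P i x ≤ ∏ i ∈ A.1, Real.exp (-truncCost P t i x) := by
                  refine Finset.prod_le_prod (fun i _ => condProb_nonneg hP i x) fun i _ => ?_
                  rw [exp_neg_truncCost P ht]
                  exact le_max_left _ _
              _ ≤ _ := by
                  rw [← Real.exp_sum, Finset.sum_neg_distrib]
                  gcongr
          · rw [if_neg fun h => h2 h.2]
            split_ifs
            positivity
        · rw [if_neg fun h => h1 h.1, if_neg h1, mul_zero]
    _ ≤ Real.exp (-T) * 1 := by
        rw [← Finset.mul_sum]
        gcongr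
        exact sum_restrict_prod_condProb_le hP A y
    _ = _ := mul_one _

/-- Truncation adds at most `t` to each of the two conditional probabilities of a bit, so each
kernel step has mass at most `1 + 2 t`. -/
theorem sum_exp_neg_truncCost_le {n : ℕ} (P : Bits n → ℝ) (hP : ∀ x, 0 ≤ P x) {t : ℝ}
    (ht : 0 < t) :
    ∑ x : Bits n, Real.exp (-∑ i, truncCost P t i x) ≤ (1 + 2 * t) ^ n := by
  have h1 : ∀ x : Bits n, Real.exp (-∑ i, truncCost P t i x)
      = ∏ i, max (condProb P i x) t := fun x => by
    rw [← Finset.sum_neg_distrib, Real.exp_sum]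
    exact Finset.prod_congr rfl fun i _ => exp_neg_truncCost P ht i x
  rw [Finset.sum_congr rfl fun x _ => h1 x]
  refine sum_prod_kernel_le (by positivity) n (fun i x => max (condProb P i x) t) ?_ ?_ ?_
  · exact fun i x => le_max_of_le_right ht.le
  · exact fun i x y h => by rw [condProb_congr P i h]
  · intro i x
    have h := condProb_update_add P i x
    have h2 : ∀ z, max (condProb P i z) t ≤ condProb P i z + t := fun z =>
      max_le (by linarith) (by linarith [condProb_nonneg hP i z])
    linarith [h2 (Function.update x i true), h2 (Function.update x i false)]

open Classical in
/-- Sampling a uniformly random set of positions preserves the min-entropy rate up to `2 d`, outside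
of an event of exponentially small probability. -/
theorem exists_sampling_bound {d : ℝ} (hd : 0 < d) :
    ∃ c > 0, ∀ (n k : ℕ) (P : Bits n → ℝ) (a : ℝ), 0 < n → (∀ x, 0 ≤ P x) → ∑ x, P x = 1 →
      (∀ x, P x ≤ Real.exp (-(a * n))) →
      ∃ good : Positions n k → Bits n → Prop,
        (∀ A y, ∑ x : Bits n, (if restrict x A = y ∧ good A x then P x else 0)
          ≤ Real.exp (-((a - 2 * d) * k))) ∧
        ∑ A : Positions n k, ∑ x : Bits n, (if good A x then 0 else P x)
          ≤ Fintype.card (Positions n k) * (Real.exp (-(c * n)) + Real.exp (-(c * k))) := by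
  -- `d / 4` makes `(1 + 2 t) ^ n` at most `exp (d n / 2)`, half of the available decay; `1 / 2`
  -- keeps the cost bound `L` positive.
  set t := min (d / 4) (1 / 2) with ht
  have ht0 : 0 < t := lt_min (by linarith) (by norm_num)
  have ht1 : t < 1 := (min_le_right _ _).trans_lt (by norm_num)
  have htd : 2 * t ≤ d / 2 := by linarith [min_le_left (d / 4) (1 / 2)]
  set L := -Real.log t with hL
  have hL0 : 0 < L := neg_pos.2 (Real.log_neg ht0 ht1)
  refine ⟨min (d / 2) (d ^ 2 / (2 * L ^ 2)), lt_min (by positivity) (by positivity), ?_⟩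
  intro n k P a hn hP hsum hmax
  have hn' : (0 : ℝ) < n := by exact_mod_cast hn
  refine ⟨fun A x => (a - 2 * d) * k ≤ ∑ i ∈ A.1, truncCost P t i x, fun A y =>
    sum_restrict_le_of_truncCost hP hsum ht0 _ A y, ?_⟩
  have hv0 : ∀ i x, 0 ≤ truncCost P t i x := fun i x =>
    neg_nonneg.2 (Real.log_nonpos (le_max_of_le_right ht0.le)
      (max_le (condProb_le_one hP i x) ht1.le))
  have hvL : ∀ i x, truncCost P t i x ≤ L := fun i x =>
    neg_le_neg (Real.log_le_log ht0 (le_max_right _ _))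
  rw [Finset.sum_comm]
  set N : ℝ := (Fintype.card (Positions n k) : ℝ) with hN
  have hcount : ∀ x : Bits n, ∑ A : Positions n k,
      (if (a - 2 * d) * k ≤ ∑ i ∈ A.1, truncCost P t i x then 0 else P x)
      = P x * ((Finset.univ.filter fun A : Positions n k =>
          ∑ i ∈ A.1, truncCost P t i x < (a - 2 * d) * k).card : ℝ) := by
    intro x
    rw [← Finset.sum_boole, Finset.mul_sum]
    refine Finset.sum_congr rfl fun A _ => ?_
    by_cases h : (a - 2 * d) * k ≤ ∑ i ∈ A.1, truncCost P t i x
    · simp [h, not_lt.2 h]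
    · simp [h, not_le.1 h]
  have hpt : ∀ x : Bits n, P x * ((Finset.univ.filter fun A : Positions n k =>
          ∑ i ∈ A.1, truncCost P t i x < (a - 2 * d) * k).card : ℝ)
      ≤ N * (Real.exp (-∑ i, truncCost P t i x) * Real.exp (-(d * n))
        + P x * Real.exp (-(d ^ 2 / (2 * L ^ 2)) * k)) := by
    intro x
    -- One `d` is lost in each case: a large total cost makes bad samples rare; a small one makes `P
    -- x` at most `exp (-d n)` times the exponential of minus its cost, which is summable.
    rcases le_or_gt ((a - d) * n) (∑ i, truncCost P t i x) with h | h
    · have h1 := card_positions_sum_lt_le (k := k) hn hL0 hd.le (fun i => hv0 i x)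
        (fun i => hvL i x) h
      rw [show a - d - d = a - 2 * d by ring] at h1
      calc _ ≤ P x * (N * Real.exp (-(d ^ 2 / (2 * L ^ 2)) * k)) := by
            gcongr
            exact hP x
        _ ≤ _ := by
            have h2 : 0 ≤ Real.exp (-∑ i, truncCost P t i x) * Real.exp (-(d * n)) := by positivity
            have h3 : 0 ≤ N := Nat.cast_nonneg _
            nlinarith [mul_nonneg h3 h2]
    · have h1 : P x ≤ Real.exp (-∑ i, truncCost P t i x) * Real.exp (-(d * n)) := by
        refine (hmax x).trans ?_
        rw [← Real.exp_add]
        gcongr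
        linarith
      have h2 : ((Finset.univ.filter fun A : Positions n k =>
          ∑ i ∈ A.1, truncCost P t i x < (a - 2 * d) * k).card : ℝ) ≤ N := by
        rw [hN]
        exact_mod_cast Finset.card_le_univ _
      calc _ ≤ Real.exp (-∑ i, truncCost P t i x) * Real.exp (-(d * n)) * N := by gcongr
        _ ≤ _ := by
            have h3 : 0 ≤ P x * Real.exp (-(d ^ 2 / (2 * L ^ 2)) * k) :=
              mul_nonneg (hP x) (Real.exp_pos _).le
            have h4 : 0 ≤ N := Nat.cast_nonneg _
            nlinarith [mul_nonneg h4 h3]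
  rw [Finset.sum_congr rfl fun x _ => hcount x]
  refine (Finset.sum_le_sum fun x _ => hpt x).trans ?_
  rw [← Finset.mul_sum, Finset.sum_add_distrib, ← Finset.sum_mul, ← Finset.sum_mul, hsum, one_mul]
  gcongr
  · calc _ ≤ (1 + 2 * t) ^ n * Real.exp (-(d * n)) := by
          gcongr
          exact sum_exp_neg_truncCost_le P hP ht0
      _ ≤ Real.exp (d / 2) ^ n * Real.exp (-(d * n)) := by
          gcongr
          linarith [Real.add_one_le_exp (d / 2)]
      _ = Real.exp (-(d / 2 * n)) := by
          rw [← Real.exp_nat_mul, ← Real.exp_add]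
          ring_nf
      _ ≤ _ := by
          gcongr
          exact min_le_left _ _
  · rw [neg_mul]
    gcongr
    exact min_le_right _ _

/-! ### Extractors applied to unnormalised weights. -/

theorem sum_toReal {α : Type} [Fintype α] (p : PMF α) : ∑ a, (p a).toReal = 1 := by
  have h := p.tsum_coe
  rw [tsum_fintype] at h
  rw [← ENNReal.toReal_sum fun a _ => p.apply_ne_top a, h, ENNReal.toReal_one]

theorem sum_abs_le_statDist {α : Type} [Fintype α] (p q : PMF α) :
    ∑ a, |(p a).toReal - (q a).toReal| ≤ 2 * statDist p q := by
  classical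
  have hle : ∀ S : Finset α, |∑ a ∈ S, ((p a).toReal - (q a).toReal)| ≤ statDist p q := fun S =>
    le_ciSup (f := fun S : Finset α => |∑ a ∈ S, ((p a).toReal - (q a).toReal)|)
      (Set.finite_range _).bddAbove S
  rw [← Finset.sum_filter_add_sum_filter_not Finset.univ fun a => (q a).toReal ≤ (p a).toReal]
  have h1 := (le_abs_self _).trans
    (hle (Finset.univ.filter fun a => (q a).toReal ≤ (p a).toReal))
  have h2 := (neg_le_abs _).trans
    (hle (Finset.univ.filter fun a => ¬ (q a).toReal ≤ (p a).toReal))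
  rw [← Finset.sum_neg_distrib] at h2
  rw [two_mul]
  refine add_le_add (le_of_eq_of_le (Finset.sum_congr rfl fun a ha => ?_) h1)
    (le_of_eq_of_le (Finset.sum_congr rfl fun a ha => ?_) h2)
  · exact abs_of_nonneg (sub_nonneg.2 (Finset.mem_filter.1 ha).2)
  · exact abs_of_nonpos (sub_nonpos.2 (not_le.1 (Finset.mem_filter.1 ha).2).le)

theorem le_of_isSource {α : Type} [Fintype α] {p : PMF α} {k : ℝ} (hp : IsSource p k) (a : α) :
    (p a).toReal ≤ (2 : ℝ) ^ (-k) := by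
  have hle : ∀ a, (p a).toReal ≤ ⨆ a, (p a).toReal := fun a =>
    le_ciSup (f := fun a => (p a).toReal) (Set.finite_range _).bddAbove a
  obtain ⟨b, hb⟩ := p.support_nonempty
  have hpos : 0 < ⨆ a, (p a).toReal :=
    (ENNReal.toReal_pos ((p.mem_support_iff b).1 hb) (p.apply_ne_top b)).trans_le (hle b)
  refine (hle a).trans ?_
  rw [← Real.logb_le_iff_le_rpow one_lt_two hpos]
  unfold IsSource minEntropy at hp
  linarith

theorem isSource_of_le {α : Type} [Fintype α] {p : PMF α} {k : ℝ}
    (hp : ∀ a, (p a).toReal ≤ (2 : ℝ) ^ (-k)) : IsSource p k := by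
  obtain ⟨b, hb⟩ := p.support_nonempty
  have : Nonempty α := ⟨b⟩
  have hpos : 0 < ⨆ a, (p a).toReal :=
    (ENNReal.toReal_pos ((p.mem_support_iff b).1 hb) (p.apply_ne_top b)).trans_le
      (le_ciSup (f := fun a => (p a).toReal) (Set.finite_range _).bddAbove b)
  have := (Real.logb_le_iff_le_rpow one_lt_two hpos).2 (ciSup_le hp)
  unfold IsSource minEntropy
  linarith

/-- The deviation of `(Ext(y, u), u)` from uniform, where `y` is weighted by `w` and `u` is
uniform. -/
noncomputable def extError {k r m : ℕ} (Ext : Bits k → Bits r → Bits m) (w : Bits k → ℝ) : ℝ :=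
  ∑ u : Bits r, ∑ e : Bits m,
    |(∑ y, if Ext y u = e then w y else 0) / 2 ^ r - (∑ y, w y) / (2 ^ m * 2 ^ r)|

theorem card_bits (n : ℕ) : Fintype.card (Bits n) = 2 ^ n := by simp

theorem extError_add_le {k r m : ℕ} (Ext : Bits k → Bits r → Bits m) (w w' : Bits k → ℝ) :
    extError Ext (fun y => w y + w' y) ≤ extError Ext w + extError Ext w' := by
  unfold extError
  rw [← Finset.sum_add_distrib]
  refine Finset.sum_le_sum fun u _ => ?_
  rw [← Finset.sum_add_distrib]
  refine Finset.sum_le_sum fun e _ => ?_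
  refine le_of_eq_of_le ?_ (abs_add_le _ _)
  have h : ∀ y, (if Ext y u = e then w y + w' y else 0)
      = (if Ext y u = e then w y else 0) + (if Ext y u = e then w' y else 0) := fun y => by
    split_ifs <;> simp
  simp only [h, Finset.sum_add_distrib]
  ring_nf

theorem extError_mul {k r m : ℕ} (Ext : Bits k → Bits r → Bits m) {c : ℝ} (hc : 0 ≤ c)
    (w : Bits k → ℝ) : extError Ext (fun y => c * w y) = c * extError Ext w := by
  unfold extError
  simp only [Finset.mul_sum]
  refine Finset.sum_congr rfl fun u _ => Finset.sum_congr rfl fun e _ => ?_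
  rw [← Finset.mul_sum, ← abs_of_nonneg hc, ← abs_mul, abs_of_nonneg hc]
  have h : ∀ y, (if Ext y u = e then c * w y else 0) = c * (if Ext y u = e then w y else 0) :=
    fun y => by split_ifs <;> simp
  simp only [h, ← Finset.mul_sum]
  ring_nf

/-- The two compared measures have the same mass, the total weight. -/
theorem extError_le {k r m : ℕ} (Ext : Bits k → Bits r → Bits m) {w : Bits k → ℝ}
    (hw : ∀ y, 0 ≤ w y) : extError Ext w ≤ 2 * ∑ y, w y := by
  have hW : 0 ≤ ∑ y, w y := Finset.sum_nonneg fun y _ => hw y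
  calc extError Ext w ≤ ∑ u : Bits r, ∑ e : Bits m,
        ((∑ y, if Ext y u = e then w y else 0) / 2 ^ r + (∑ y, w y) / (2 ^ m * 2 ^ r)) := by
        refine Finset.sum_le_sum fun u _ => Finset.sum_le_sum fun e _ => ?_
        have h1 : 0 ≤ ∑ y, (if Ext y u = e then w y else 0) :=
          Finset.sum_nonneg fun y _ => by split_ifs <;> simp [hw]
        refine (abs_sub _ _).trans ?_
        rw [abs_of_nonneg (by positivity), abs_of_nonneg (by positivity)]
    _ = 2 * ∑ y, w y := by
        have h2 : ∀ u : Bits r, ∑ e : Bits m, (∑ y, if Ext y u = e then w y else 0)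
            = ∑ y, w y := fun u => by
          rw [Finset.sum_comm]
          simp
        simp only [Finset.sum_add_distrib, ← Finset.sum_div, h2, Finset.sum_const,
          Finset.card_univ, card_bits, nsmul_eq_mul]
        push_cast
        field_simp
        ring

theorem extError_le_of_isStrongExtractor {k r m : ℕ} {Ext : Bits k → Bits r → Bits m}
    {kE ε : ℝ} (hExt : IsStrongExtractor Ext kE ε) {w : Bits k → ℝ} (hw : ∀ y, 0 ≤ w y)
    (hsum : ∑ y, w y = 1) (hle : ∀ y, w y ≤ (2 : ℝ) ^ (-kE)) : extError Ext w ≤ 2 * ε := by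
  have hone : ∑ y, ENNReal.ofReal (w y) = 1 := by
    rw [← ENNReal.ofReal_sum_of_nonneg fun y _ => hw y, hsum, ENNReal.ofReal_one]
  have hX : ∀ y, (PMF.ofFintype _ hone y).toReal = w y := fun y => by
    rw [PMF.ofFintype_apply, ENNReal.toReal_ofReal (hw y)]
  have h1 := hExt (PMF.ofFintype _ hone) (isSource_of_le fun y => (hX y).trans_le (hle y))
  have h2 := (sum_abs_le_statDist _ _).trans (mul_le_mul_of_nonneg_left h1 zero_le_two)
  refine le_of_eq_of_le ?_ h2
  rw [Fintype.sum_prod_type, Finset.sum_comm]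
  refine Finset.sum_congr rfl fun u _ => Finset.sum_congr rfl fun e _ => ?_
  congr 2
  · rw [PMF.bind_apply, tsum_fintype, ENNReal.toReal_sum, Finset.sum_div]
    · refine Finset.sum_congr rfl fun y _ => ?_
      rw [ENNReal.toReal_mul, hX, PMF.map_apply, tsum_fintype, Finset.sum_eq_single u]
      · by_cases h : Ext y u = e
        · simp [h, PMF.uniformOfFintype_apply, div_eq_mul_inv]
        · simp [h, Ne.symm h]
      · intro u' _ hu'
        rw [if_neg]
        exact fun h => hu' (Prod.ext_iff.1 h).2.symm
      · simp
    · exact fun y _ => ENNReal.mul_ne_top (PMF.apply_ne_top _ _) (PMF.apply_ne_top _ _)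
  · rw [hsum]
    simp [PMF.uniformOfFintype_apply]

/-- If the weight exceeds `c * 2 ^ kE`, normalising gives a `kE`-source; otherwise the trivial bound
already suffices. -/
theorem extError_le_of_le {k r m : ℕ} {Ext : Bits k → Bits r → Bits m}
    {kE ε : ℝ} (hExt : IsStrongExtractor Ext kE ε) {w : Bits k → ℝ} (hw : ∀ y, 0 ≤ w y) {c : ℝ}
    (hc : 0 ≤ c) (hle : ∀ y, w y ≤ c) :
    extError Ext w ≤ 2 * |ε| * ∑ y, w y + 2 * (c * 2 ^ kE) := by
  set W := ∑ y, w y with hW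
  have hW0 : 0 ≤ W := Finset.sum_nonneg fun y _ => hw y
  have h2 : (0 : ℝ) < 2 ^ kE := by positivity
  rcases le_or_gt W (c * 2 ^ kE) with h | h
  · have := extError_le Ext hw
    have h3 : 0 ≤ 2 * |ε| * W := by positivity
    linarith
  · have hWpos : 0 < W := lt_of_le_of_lt (by positivity) h
    have h3 : extError Ext (fun y => W⁻¹ * w y) ≤ 2 * ε := by
      refine extError_le_of_isStrongExtractor hExt (fun y => by have := hw y; positivity) ?_
        fun y => ?_
      · rw [← Finset.mul_sum, ← hW, inv_mul_cancel₀ hWpos.ne']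
      · rw [Real.rpow_neg zero_le_two, inv_mul_le_iff₀ hWpos, ← div_eq_mul_inv,
          le_div_iff₀ h2]
        have := hle y
        nlinarith
    rw [extError_mul Ext (by positivity), inv_mul_le_iff₀ hWpos] at h3
    have h4 := le_abs_self ε
    have h5 : 0 ≤ c * 2 ^ kE := by positivity
    nlinarith

/-- The part `w` is cut into `2 ^ q` pieces, each paying the additive loss once: this is the cost of
`q` bits of entropy. The exceptional part `w'` is bounded trivially. -/
theorem sum_extError_hash_le {k q r m : ℕ} {Ext : Bits k → Bits r → Bits m}
    {kE ε : ℝ} (hExt : IsStrongExtractor Ext kE ε) (H : Bits k → Bits q) {w w' : Bits k → ℝ}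
    (hw : ∀ y, 0 ≤ w y) (hw' : ∀ y, 0 ≤ w' y) {c : ℝ} (hc : 0 ≤ c) (hle : ∀ y, w y ≤ c) :
    ∑ z : Bits q, extError Ext (fun y => if H y = z then w y + w' y else 0)
      ≤ 2 * |ε| * ∑ y, w y + 2 * (2 ^ q * c * 2 ^ kE) + 2 * ∑ y, w' y := by
  have hfib : ∀ v : Bits k → ℝ, ∑ z : Bits q, ∑ y, (if H y = z then v y else 0) = ∑ y, v y :=
    fun v => by rw [Finset.sum_comm]; simp
  calc _ ≤ ∑ z : Bits q, (2 * |ε| * ∑ y, (if H y = z then w y else 0) + 2 * (c * 2 ^ kE)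
        + 2 * ∑ y, (if H y = z then w' y else 0)) := by
        refine Finset.sum_le_sum fun z _ => ?_
        have h : (fun y => if H y = z then w y + w' y else 0)
            = fun y => (if H y = z then w y else 0) + (if H y = z then w' y else 0) := by
          funext y; split_ifs <;> simp
        rw [h]
        refine (extError_add_le _ _ _).trans (add_le_add ?_ ?_)
        · refine extError_le_of_le hExt (fun y => ?_) hc fun y => ?_
          · split_ifs <;> simp [hw]
          · split_ifs
            · exact hle y
            · exact hc
        · exact extError_le Ext fun y => by split_ifs <;> simp [hw']
    _ = _ := by
        simp only [Finset.sum_add_distrib, ← Finset.mul_sum, hfib, Finset.sum_const,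
          Finset.card_univ, card_bits, nsmul_eq_mul]
        push_cast
        ring

/-! ### Entropy and masking. -/

theorem toReal_bind {α β : Type} [Fintype α] (p : PMF α) (f : α → PMF β) (b : β) :
    (p.bind f b).toReal = ∑ a, (p a).toReal * (f a b).toReal := by
  rw [PMF.bind_apply, tsum_fintype, ENNReal.toReal_sum]
  · exact Finset.sum_congr rfl fun a _ => ENNReal.toReal_mul
  · exact fun a _ => ENNReal.mul_ne_top (PMF.apply_ne_top _ _) (PMF.apply_ne_top _ _)

open Classical in
theorem toReal_map {α β : Type} [Fintype α] (p : PMF α) (f : α → β) (b : β) :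
    (p.map f b).toReal = ∑ a, if f a = b then (p a).toReal else 0 := by
  rw [PMF.map_apply, tsum_fintype, ENNReal.toReal_sum]
  · refine Finset.sum_congr rfl fun a _ => ?_
    by_cases h : f a = b
    · simp [h]
    · simp [h, Ne.symm h]
  · intro a _
    split_ifs
    · exact p.apply_ne_top a
    · exact ENNReal.zero_ne_top

theorem toReal_map_perm {α : Type} [Fintype α] (p : PMF α) (σ : Equiv.Perm α) (b : α) :
    (p.map σ b).toReal = (p (σ.symm b)).toReal := by
  classical
  rw [toReal_map, Finset.sum_eq_single (σ.symm b)]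
  · simp
  · intro a _ ha
    rw [if_neg]
    rintro rfl
    simp at ha
  · simp

/-- Given `v`, the second component is a permuted copy of `D`, so the chain rule has a constant
conditional entropy. -/
theorem entropy_bind_map_perm {α T : Type} [Fintype α] [Fintype T] (V : PMF α) (D : PMF T)
    (σ : α → Equiv.Perm T) :
    entropy (V.bind fun v => D.map fun t => (v, σ v t)) = entropy V + entropy D := by
  classical
  have hval : ∀ v t, ((V.bind fun v => D.map fun t => (v, σ v t)) (v, t)).toReal
      = (V v).toReal * (D ((σ v).symm t)).toReal := by
    intro v t
    rw [toReal_bind, Finset.sum_eq_single v]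
    · rw [← toReal_map_perm D (σ v) t, toReal_map, toReal_map]
      simp
    · intro v' _ hv'
      rw [toReal_map, Finset.sum_eq_zero, mul_zero]
      intro t' _
      rw [if_neg]
      exact fun h => hv' (Prod.ext_iff.1 h).1
    · simp
  unfold entropy
  rw [← add_div, Fintype.sum_prod_type]
  congr 1
  have h1 : ∀ v, ∑ t, Real.negMulLog ((V.bind fun v => D.map fun t => (v, σ v t)) (v, t)).toReal
      = Real.negMulLog (V v).toReal + (V v).toReal * ∑ t, Real.negMulLog (D t).toReal := by
    intro v
    simp only [hval, Real.negMulLog_mul]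
    rw [(σ v).symm.sum_comp fun t => (D t).toReal * Real.negMulLog (V v).toReal
      + (V v).toReal * Real.negMulLog (D t).toReal, Finset.sum_add_distrib, ← Finset.sum_mul,
      sum_toReal, one_mul, Finset.mul_sum]
  rw [Finset.sum_congr rfl fun v _ => h1 v, Finset.sum_add_distrib, ← Finset.sum_mul, sum_toReal,
    one_mul]

theorem negMulLog_le_cross {d p N : ℝ} (hd : 0 ≤ d) (hdp : d ≤ p) (hN : 0 < N) :
    Real.negMulLog d ≤ d * Real.log N - d * Real.log p + (p / N - d) := by
  rcases hd.eq_or_lt with rfl | hd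
  · simpa using div_nonneg hdp hN.le
  have hp : 0 < p := hd.trans_le hdp
  have h1 := Real.log_le_sub_one_of_pos (show 0 < p / (N * d) by positivity)
  rw [Real.log_div hp.ne' (by positivity), Real.log_mul hN.ne' hd.ne'] at h1
  have h2 := mul_le_mul_of_nonneg_left h1 hd.le
  have h3 : d * (p / (N * d) - 1) = p / N - d := by field_simp
  rw [h3] at h2
  rw [Real.negMulLog]
  linarith

theorem cross_sub_negMulLog_le {d p N : ℝ} (hd : 0 ≤ d) (hdp : d ≤ p) (hN : 1 ≤ N) :
    d * Real.log N - d * Real.log p - Real.negMulLog d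
      ≤ (1 + Real.log N) * |d - p / N| := by
  have hlogN : 0 ≤ Real.log N := Real.log_nonneg hN
  rcases hd.eq_or_lt with rfl | hd
  · simp; positivity
  have hp : 0 < p := hd.trans_le hdp
  have hN0 : 0 < N := by linarith
  have h0 : d * Real.log N - d * Real.log p - Real.negMulLog d = d * Real.log (N * d / p) := by
    rw [Real.log_div (by positivity) hp.ne', Real.log_mul hN0.ne' hd.ne', Real.negMulLog]
    ring
  rw [h0]
  rcases le_or_gt (p / N) d with h | h
  -- Split `d` as `p / N + (d - p / N)`: on the first part `log x ≤ x - 1`, on the second the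
  -- logarithm is at most `log N`.
  · rw [abs_of_nonneg (sub_nonneg.2 h)]
    have h1 := Real.log_le_sub_one_of_pos (show 0 < N * d / p by positivity)
    have h2 : Real.log (N * d / p) ≤ Real.log N := by
      apply Real.log_le_log (by positivity)
      rw [div_le_iff₀ hp]
      gcongr
    have h3 : p / N * (N * d / p - 1) = d - p / N := by field_simp
    have h4 := mul_le_mul_of_nonneg_left h1 (show 0 ≤ p / N by positivity)
    have h5 := mul_le_mul_of_nonneg_left h2 (sub_nonneg.2 h)
    rw [h3] at h4
    linarith
  · have h1 : Real.log (N * d / p) ≤ 0 := by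
      apply Real.log_nonpos (by positivity)
      rw [div_le_one hp]
      rw [lt_div_iff₀ hN0] at h
      linarith
    have h2 : 0 ≤ (1 + Real.log N) * |d - p / N| := by positivity
    nlinarith

/-- Both sums are compared with `p log N - p log p`, the value for mass `p` spread uniformly: `d'`
cannot exceed it, and `d` falls short by at most its weighted deviation. -/
theorem sum_negMulLog_sub_le {E : Type} [Fintype E] [Nonempty E] (d d' : E → ℝ)
    (hd : ∀ x, 0 ≤ d x) (hd' : ∀ x, 0 ≤ d' x) (h : ∑ x, d x = ∑ x, d' x) :
    ∑ x, Real.negMulLog (d' x) - ∑ x, Real.negMulLog (d x)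
      ≤ (1 + Real.log (Fintype.card E)) * ∑ x, |d x - (∑ y, d y) / Fintype.card E| := by
  set N : ℝ := (Fintype.card E : ℝ) with hN
  have hN1 : 1 ≤ N := by rw [hN]; exact_mod_cast Fintype.card_pos
  set p := ∑ x, d x with hp
  have hle : ∀ x, d x ≤ p := fun x =>
    Finset.single_le_sum (fun y _ => hd y) (Finset.mem_univ x)
  have hle' : ∀ x, d' x ≤ p := fun x => h ▸
    Finset.single_le_sum (fun y _ => hd' y) (Finset.mem_univ x)
  have h1 := Finset.sum_le_sum fun x (_ : x ∈ Finset.univ) =>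
    negMulLog_le_cross (hd' x) (hle' x) (zero_lt_one.trans_le hN1)
  have h2 := Finset.sum_le_sum fun x (_ : x ∈ Finset.univ) =>
    cross_sub_negMulLog_le (hd x) (hle x) hN1
  simp only [Finset.sum_add_distrib, Finset.sum_sub_distrib, ← Finset.sum_mul, ← Finset.mul_sum,
    ← h, ← hp, Finset.sum_const, Finset.card_univ, nsmul_eq_mul, ← hN] at h1 h2
  have h3 : N * (p / N) = p := mul_div_cancel₀ _ (zero_lt_one.trans_le hN1).ne'
  linarith

/-- Masking a component of a joint distribution with an independent value reveals about this value
at most the deviation from uniform of that component, given the rest. -/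
theorem condMutualInfo_mask_le {α E Y Z F : Type} [Fintype α] [Fintype E] [Nonempty E]
    [Fintype Y] [Fintype Z] [Fintype F] (V : PMF α) (D : PMF (Y × F)) (e : Y ≃ E × Z)
    (π : α → Equiv.Perm E) :
    condMutualInfo (V.bind fun v => D.map fun t =>
        (v, (e.symm (π v (e t.1).1, (e t.1).2), t.2)))
      ≤ (1 + Real.log (Fintype.card E)) / Real.log 2 * ∑ f : F, ∑ z : Z, ∑ x : E,
        |(D (e.symm (x, z), f)).toReal
          - (∑ y : E, (D (e.symm (y, z), f)).toReal) / Fintype.card E| := by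
  classical
  let ρ : α → Equiv.Perm Y := fun v => (e.trans ((π v).prodCongr (Equiv.refl Z))).trans e.symm
  let σ : α → Equiv.Perm (Y × F) := fun v => (ρ v).prodCongr (Equiv.refl F)
  change condMutualInfo (V.bind fun v => D.map fun t => (v, σ v t)) ≤ _
  set p := V.bind fun v => D.map fun t => (v, σ v t) with hp
  have hVF : p.map (fun t => (t.1, t.2.2))
      = V.bind fun v => (D.map Prod.snd).map fun f => (v, (1 : Equiv.Perm F) f) := by
    rw [hp, PMF.map_bind]
    simp only [PMF.map_comp]
    rfl
  have hF : p.map (fun t => t.2.2) = D.map Prod.snd := by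
    rw [hp, PMF.map_bind]
    simp only [PMF.map_comp]
    exact PMF.bind_const V (D.map Prod.snd)
  have hY : p.map (fun t => t.2) = V.bind fun v => D.map (σ v) := by
    rw [hp, PMF.map_bind]
    simp only [PMF.map_comp]
    rfl
  have hent : condMutualInfo p = entropy (V.bind fun v => D.map (σ v)) - entropy D := by
    unfold condMutualInfo
    rw [hVF, hF, hY, entropy_bind_map_perm V (D.map Prod.snd) fun _ => 1, hp,
      entropy_bind_map_perm V D σ]
    ring
  have hlog : 0 < Real.log 2 := Real.log_pos one_lt_two
  rw [hent]
  unfold entropy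
  rw [← sub_div, div_mul_eq_mul_div]
  gcongr
  have hsum : ∀ q : Y × F → ℝ, ∑ t, q t = ∑ f : F, ∑ z : Z, ∑ x : E, q (e.symm (x, z), f) := by
    intro q
    rw [Fintype.sum_prod_type, Finset.sum_comm]
    refine Finset.sum_congr rfl fun f _ => ?_
    rw [← e.symm.sum_comp, Fintype.sum_prod_type, Finset.sum_comm]
  rw [hsum, hsum, ← Finset.sum_sub_distrib, Finset.mul_sum]
  refine Finset.sum_le_sum fun f _ => ?_
  rw [← Finset.sum_sub_distrib, Finset.mul_sum]
  refine Finset.sum_le_sum fun z _ => ?_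
  refine sum_negMulLog_sub_le (fun x => (D (e.symm (x, z), f)).toReal) _
    (fun x => ENNReal.toReal_nonneg) (fun x => ENNReal.toReal_nonneg) ?_
  simp only [toReal_bind, toReal_map_perm]
  rw [Finset.sum_comm]
  have h1 : ∀ v, ∑ x : E, (V v).toReal * (D ((σ v).symm (e.symm (x, z), f))).toReal
      = (V v).toReal * ∑ x : E, (D (e.symm (x, z), f)).toReal := by
    intro v
    rw [← Finset.mul_sum, ← (π v).symm.sum_comp fun x => (D (e.symm (x, z), f)).toReal]
    congr 1
    refine Finset.sum_congr rfl fun x _ => ?_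
    congr 2
    simp [σ, ρ]
  rw [Finset.sum_congr rfl fun v _ => h1 v, ← Finset.sum_mul, sum_toReal, one_mul]

/-! ### Extraction from a random sample of a weighted source. -/

/-- The weight of the strings whose restriction to `A` is `y`. -/
def fiberWeight {n k : ℕ} (w : Bits n → ℝ) (A : Positions n k) (y : Bits k) : ℝ :=
  ∑ x, if restrict x A = y then w x else 0

theorem sum_fiberWeight {n k : ℕ} (w : Bits n → ℝ) (A : Positions n k) (c : Bits k → Prop)
    [DecidablePred c] :
    ∑ y, (if c y then fiberWeight w A y else 0) = ∑ x, if c (restrict x A) then w x else 0 := by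
  unfold fiberWeight
  calc _ = ∑ y, ∑ x, (if restrict x A = y then (if c (restrict x A) then w x else 0) else 0) := by
        refine Finset.sum_congr rfl fun y _ => ?_
        split_ifs with h
        · refine Finset.sum_congr rfl fun x _ => ?_
          by_cases hx : restrict x A = y
          · simp [hx, h]
          · simp [hx]
        · refine (Finset.sum_eq_zero fun x _ => ?_).symm
          by_cases hx : restrict x A = y
          · simp [hx, h]
          · simp [hx]
    _ = _ := by rw [Finset.sum_comm]; simp

theorem sum_extError_fiber_le {n k q r m : ℕ} (Ext : Bits k → Bits r → Bits m)
    (H : Bits k → Bits q) {w : Bits n → ℝ} (hw : ∀ x, 0 ≤ w x) (A : Positions n k) :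
    ∑ z : Bits q, extError Ext (fun y => if H y = z then fiberWeight w A y else 0)
      ≤ 2 * ∑ x, w x := by
  have hf : ∀ y, 0 ≤ fiberWeight w A y := fun y =>
    Finset.sum_nonneg fun x _ => by split_ifs <;> simp [hw]
  calc _ ≤ ∑ z : Bits q, 2 * ∑ y, (if H y = z then fiberWeight w A y else 0) :=
        Finset.sum_le_sum fun z _ => extError_le Ext fun y => by split_ifs <;> simp [hf]
    _ = 2 * ∑ x, w x := by
        simp only [sum_fiberWeight]
        rw [← Finset.mul_sum, Finset.sum_comm]
        simp

open Classical in
/-- On a random sample of a weighted source that is bounded by `2 ^ (-α n)`, the extractor output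
is close to uniform on average, given a hash value of the sample. -/
theorem exists_sum_extError_bound {τ : ℝ} (hτ : 0 < τ) :
    ∃ c > 0, ∀ (n k q r m : ℕ) (Ext : Bits k → Bits r → Bits m) (kE ε α ρ : ℝ)
      (H : Bits k → Bits q) (w : Bits n → ℝ), 0 < n → IsStrongExtractor Ext kE ε →
      (∀ x, 0 ≤ w x) → (∀ x, w x ≤ (2 : ℝ) ^ (-(α * n))) → q + kE ≤ (ρ - 3 * τ) * k →
      ∑ A : Positions n k,
        ∑ z : Bits q, extError Ext (fun y => if H y = z then fiberWeight w A y else 0)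
      ≤ Fintype.card (Positions n k) * (2 * (2 : ℝ) ^ ((ρ - α) * n) + (∑ x, w x) *
        (2 * |ε| + 2 * (2 : ℝ) ^ (-(τ * k)) + 2 * (Real.exp (-(c * n)) + Real.exp (-(c * k))))) := by
  have hl : 0 < Real.log 2 := Real.log_pos one_lt_two
  have h2 : ∀ x : ℝ, (2 : ℝ) ^ x = Real.exp (x * Real.log 2) := fun x => by
    rw [Real.rpow_def_of_pos two_pos, mul_comm]
  obtain ⟨c, hc, hsamp⟩ := exists_sampling_bound (mul_pos hτ hl)
  refine ⟨c, hc, ?_⟩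
  intro n k q r m Ext kE ε α ρ H w hn hExt hw hwle hkE
  set W := ∑ x, w x with hW
  have hW0 : 0 ≤ W := Finset.sum_nonneg fun x _ => hw x
  set N : ℝ := (Fintype.card (Positions n k) : ℝ) with hN
  have hN0 : 0 ≤ N := Nat.cast_nonneg _
  have hB : 0 ≤ 2 * |ε| + 2 * (2 : ℝ) ^ (-(τ * k))
      + 2 * (Real.exp (-(c * n)) + Real.exp (-(c * k))) := by positivity
  rcases le_or_gt W ((2 : ℝ) ^ ((ρ - α) * n)) with hsmall | hlarge
  · calc _ ≤ ∑ A : Positions n k, 2 * (2 : ℝ) ^ ((ρ - α) * n) :=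
          Finset.sum_le_sum fun A _ =>
            (sum_extError_fiber_le Ext H hw A).trans (by gcongr)
      _ ≤ _ := by
          rw [Finset.sum_const, Finset.card_univ, nsmul_eq_mul, ← hN]
          gcongr
          have := mul_nonneg hW0 hB
          linarith
  have hWpos : 0 < W := lt_trans (by positivity) hlarge
  -- Dividing by a weight above `2 ^ ((ρ - α) n)` turns the bound `2 ^ (-α n)` into `2 ^ (-ρ n)`;
  -- the factors `Real.log 2` convert bits to nats.
  obtain ⟨good, hgood, hbad⟩ := hsamp n k (fun x => w x / W) (ρ * Real.log 2) hn
    (fun x => by have := hw x; positivity) (by rw [← Finset.sum_div, div_self hWpos.ne']) (by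
      intro x
      rw [div_le_iff₀ hWpos]
      calc w x ≤ (2 : ℝ) ^ (-(α * n)) := hwle x
        _ = Real.exp (-(ρ * Real.log 2 * n)) * (2 : ℝ) ^ ((ρ - α) * n) := by
            rw [h2, h2, ← Real.exp_add]; ring_nf
        _ ≤ _ := by gcongr)
  set v : Positions n k → Bits k → ℝ := fun A y =>
    ∑ x, if restrict x A = y ∧ good A x then w x else 0 with hv
  set v' : Positions n k → Bits k → ℝ := fun A y =>
    ∑ x, if restrict x A = y ∧ ¬ good A x then w x else 0 with hv'
  have hv0 : ∀ A y, 0 ≤ v A y := fun A y =>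
    Finset.sum_nonneg fun x _ => by split_ifs <;> simp [hw]
  have hv0' : ∀ A y, 0 ≤ v' A y := fun A y =>
    Finset.sum_nonneg fun x _ => by split_ifs <;> simp [hw]
  have hvv : ∀ A y, fiberWeight w A y = v A y + v' A y := by
    intro A y
    rw [hv, hv', fiberWeight, ← Finset.sum_add_distrib]
    refine Finset.sum_congr rfl fun x _ => ?_
    by_cases h1 : restrict x A = y <;> by_cases h3 : good A x <;> simp [h1, h3]
  have hvle : ∀ A y, v A y ≤ W * (2 : ℝ) ^ (-((ρ - 2 * τ) * k)) := by
    intro A y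
    have h := hgood A y
    have h3 : ∑ x, (if restrict x A = y ∧ good A x then w x / W else 0) = v A y / W := by
      rw [hv, Finset.sum_div]
      refine Finset.sum_congr rfl fun x _ => ?_
      split_ifs <;> simp
    rw [h3, div_le_iff₀ hWpos] at h
    refine h.trans (le_of_eq ?_)
    rw [h2, mul_comm]
    ring_nf
  have hvsum : ∀ A, ∑ y, v A y ≤ W := by
    intro A
    rw [hv, Finset.sum_comm, hW]
    refine Finset.sum_le_sum fun x _ => ?_
    by_cases h : good A x <;> simp [h, hw]
  have hvsum' : ∀ A, ∑ y, v' A y = W * ∑ x, (if good A x then 0 else w x / W) := by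
    intro A
    rw [hv', Finset.sum_comm, Finset.mul_sum]
    refine Finset.sum_congr rfl fun x _ => ?_
    by_cases h : good A x <;> simp [h, mul_div_cancel₀ _ hWpos.ne']
  have hpow : (2 : ℝ) ^ q * (2 : ℝ) ^ (-((ρ - 2 * τ) * k)) * (2 : ℝ) ^ kE
      ≤ (2 : ℝ) ^ (-(τ * k)) := by
    rw [← Real.rpow_natCast, ← Real.rpow_add two_pos, ← Real.rpow_add two_pos]
    apply Real.rpow_le_rpow_of_exponent_le one_le_two
    linarith
  have hA : ∀ A : Positions n k,
      ∑ z : Bits q, extError Ext (fun y => if H y = z then fiberWeight w A y else 0)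
      ≤ W * (2 * |ε| + 2 * (2 : ℝ) ^ (-(τ * k)))
        + 2 * W * ∑ x, (if good A x then 0 else w x / W) := by
    intro A
    simp only [hvv]
    refine (sum_extError_hash_le hExt H (hv0 A) (hv0' A) (by positivity) (hvle A)).trans ?_
    rw [hvsum']
    have h3 : 2 * |ε| * ∑ y, v A y ≤ 2 * |ε| * W := by
      gcongr
      exact hvsum A
    have h4 := mul_le_mul_of_nonneg_left hpow hW0
    nlinarith
  refine (Finset.sum_le_sum fun A _ => hA A).trans ?_
  rw [Finset.sum_add_distrib, Finset.sum_const, Finset.card_univ, nsmul_eq_mul, ← hN]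
  have h3 := mul_le_mul_of_nonneg_left hbad (show 0 ≤ 2 * W by positivity)
  rw [Finset.mul_sum] at h3
  have h4 : 0 ≤ N * (2 * (2 : ℝ) ^ ((ρ - α) * n)) := by positivity
  calc _ ≤ N * (W * (2 * |ε| + 2 * (2 : ℝ) ^ (-(τ * k))))
        + 2 * W * (N * (Real.exp (-(c * n)) + Real.exp (-(c * k)))) := by gcongr
    _ ≤ _ := by linarith

/-! ### Bob's view of the protocol. -/

theorem card_memory_le (s : ℕ) : (Fintype.card (Memory s) : ℝ) ≤ 2 ^ (s + 1) := by
  have h : Fintype.card (Memory s) = ∑ j ∈ Finset.range (s + 1), 2 ^ j := by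
    rw [Fintype.card_sigma, Finset.sum_range]
    simp
  have h2 : Fintype.card (Memory s) ≤ 2 ^ (s + 1) := by
    rw [h]
    exact (Nat.geomSum_lt le_rfl fun k hk => Finset.mem_range.1 hk).le
  exact_mod_cast h2

theorem bxor_bxor {m : ℕ} (v x : Bits m) : bxor v (bxor v x) = x := by
  funext i
  simp [bxor]

/-- Masking with `v`. -/
def bxorPerm {m : ℕ} (v : Bits m) : Equiv.Perm (Bits m) where
  toFun := bxor v
  invFun := bxor v
  left_inv := bxor_bxor v
  right_inv := bxor_bxor v

/-- Separates the concealed value from the rest of Bob's view. -/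
def viewEquiv (R κ : Type) (n k q m r : ℕ) :
    R × Transcript κ n k q m r ≃ Bits m × (R × κ × Bits q × Positions n k × Bits r) where
  toFun t := (t.2.2.1, (t.1, t.2.1, t.2.2.2))
  invFun t := (t.2.1, (t.2.2.1, t.1, t.2.2.2))
  left_inv _ := rfl
  right_inv _ := rfl

/-- The view of Bob and his memory when the extracted string is not masked. -/
noncomputable def unmaskedView {κ R : Type} {n k q m r s : ℕ} (hk : k ≤ n)
    (G : κ → Bits k → Bits q) (Ext : Bits k → Bits r → Bits m) (source : PMF (Bits n × Bits n))
    (B : Bob κ n s R) : PMF ((R × Transcript κ n k q m r) × Memory s) :=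
  source.bind fun x =>
  B.coins.bind fun b =>
  (uniformPositions hk).bind fun A =>
  (PMF.uniformOfFintype (Bits r)).map fun u =>
    ((b, (B.query (B.store x.2 b) b, Ext (restrict x.1 A) u,
      G (B.query (B.store x.2 b) b) (restrict x.1 A), A, u)), B.store x.2 b)

/-- Independence lets `V` be drawn first; it then acts only by the mask on the view of an unmasked
run. -/
theorem execution_eq {κ R : Type} {n k q m r s : ℕ} (hk : k ≤ n)
    (G : κ → Bits k → Bits q) (Ext : Bits k → Bits r → Bits m) (source : PMF (Bits n × Bits n))
    (V : PMF (Bits m)) (B : Bob κ n s R) :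
    execution hk G Ext source V B = V.bind fun v => (unmaskedView hk G Ext source B).map fun t =>
      (v, ((viewEquiv R κ n k q m r).symm (bxorPerm v (viewEquiv R κ n k q m r t.1).1,
        (viewEquiv R κ n k q m r t.1).2), t.2)) := by
  unfold execution unmaskedView
  rw [PMF.bind_comm]
  simp only [PMF.map_bind, PMF.map_comp]
  rfl

open Classical in
/-- The weight of the source strings with which Bob stores `f`, given his randomness `b`. -/
noncomputable def memoryWeight {κ R : Type} {n s : ℕ} (source : PMF (Bits n × Bits n))
    (B : Bob κ n s R) (b : R) (f : Memory s) (x : Bits n) : ℝ :=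
  ∑ x', if B.store x' b = f then (source (x, x')).toReal else 0

theorem memoryWeight_nonneg {κ R : Type} {n s : ℕ} (source : PMF (Bits n × Bits n))
    (B : Bob κ n s R) (b : R) (f : Memory s) (x : Bits n) : 0 ≤ memoryWeight source B b f x :=
  Finset.sum_nonneg fun y _ => by split_ifs <;> simp

theorem memoryWeight_le {κ R : Type} {n s : ℕ} (source : PMF (Bits n × Bits n))
    (B : Bob κ n s R) (b : R) (f : Memory s) (x : Bits n) :
    memoryWeight source B b f x ≤ ((source.map Prod.fst) x).toReal := by
  classical
  rw [toReal_map, Fintype.sum_prod_type, Finset.sum_eq_single x]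
  · unfold memoryWeight
    refine Finset.sum_le_sum fun y _ => ?_
    rw [if_pos rfl]
    split_ifs <;> simp
  · intro y _ hy
    simp [hy]
  · simp

theorem sum_memoryWeight {κ R : Type} {n s : ℕ} (source : PMF (Bits n × Bits n))
    (B : Bob κ n s R) (b : R) : ∑ f, ∑ x, memoryWeight source B b f x = 1 := by
  classical
  rw [Finset.sum_comm, ← sum_toReal source, Fintype.sum_prod_type]
  refine Finset.sum_congr rfl fun x _ => ?_
  unfold memoryWeight
  rw [Finset.sum_comm]
  simp

-- Bob's query depends only on `f` and `b`, so given these the hash is fixed, and the coins,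
-- positions and seed contribute independent factors.
open Classical in
theorem toReal_unmaskedView {κ R : Type} [Fintype R] {n k q m r s : ℕ} (hk : k ≤ n)
    (G : κ → Bits k → Bits q) (Ext : Bits k → Bits r → Bits m) (source : PMF (Bits n × Bits n))
    (B : Bob κ n s R) (b : R) (g : κ) (ω : Bits m) (z : Bits q) (A : Positions n k) (u : Bits r)
    (f : Memory s) :
    (unmaskedView hk G Ext source B ((b, (g, ω, z, A, u)), f)).toReal
      = if B.query f b = g then (B.coins b).toReal / Fintype.card (Positions n k) *
        ((∑ y, if Ext y u = ω then
          (if G (B.query f b) y = z then fiberWeight (memoryWeight source B b f) A y else 0)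
          else 0) / 2 ^ r) else 0 := by
  have hinner : (∑ y, if Ext y u = ω then
          (if G (B.query f b) y = z then fiberWeight (memoryWeight source B b f) A y else 0)
          else 0) = ∑ x : Bits n × Bits n, if (Ext (restrict x.1 A) u = ω ∧
            G (B.query f b) (restrict x.1 A) = z) ∧ B.store x.2 b = f
            then (source x).toReal else 0 := by
    simp only [← ite_and]
    rw [sum_fiberWeight, Fintype.sum_prod_type]
    refine Finset.sum_congr rfl fun x _ => ?_
    rw [memoryWeight]
    by_cases h : Ext (restrict x A) u = ω ∧ G (B.query f b) (restrict x A) = z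
    · simp [h]
    · simp [h]
  rw [hinner]
  unfold unmaskedView
  rw [toReal_bind]
  have hx : ∀ x : Bits n × Bits n, (((B.coins.bind fun b => (uniformPositions hk).bind fun A =>
      (PMF.uniformOfFintype (Bits r)).map fun u =>
        ((b, (B.query (B.store x.2 b) b, Ext (restrict x.1 A) u,
        G (B.query (B.store x.2 b) b) (restrict x.1 A), A, u)), B.store x.2 b))
        ((b, (g, ω, z, A, u)), f)).toReal)
      = if (Ext (restrict x.1 A) u = ω ∧ G (B.query f b) (restrict x.1 A) = z) ∧
          B.store x.2 b = f ∧ B.query f b = g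
          then (B.coins b).toReal * ((Fintype.card (Positions n k) : ℝ)⁻¹ * (2 ^ r)⁻¹) else 0 := by
    intro x
    rw [toReal_bind, Finset.sum_eq_single b, toReal_bind, Finset.sum_eq_single A, toReal_map,
      Finset.sum_eq_single u]
    · have hA : (uniformPositions hk A).toReal = (Fintype.card (Positions n k) : ℝ)⁻¹ := by
        simp [uniformPositions, PMF.uniformOfFintype_apply]
      have hu : (PMF.uniformOfFintype (Bits r) u).toReal = (2 ^ r)⁻¹ := by
        simp [PMF.uniformOfFintype_apply]
      rw [hA, hu]
      by_cases hf : B.store x.2 b = f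
      · subst hf
        by_cases h1 : Ext (restrict x.1 A) u = ω <;>
          by_cases h2 : G (B.query (B.store x.2 b) b) (restrict x.1 A) = z <;>
          by_cases h3 : B.query (B.store x.2 b) b = g <;> simp [h1, h2, h3]
      · simp [hf]
    · intro u' _ hu'
      simp [hu']
    · simp
    · intro A' _ hA'
      rw [toReal_map, Finset.sum_eq_zero, mul_zero]
      intro u' _
      simp [hA']
    · simp
    · intro b' _ hb'
      rw [toReal_bind, Finset.sum_eq_zero, mul_zero]
      intro A' _
      rw [toReal_map, Finset.sum_eq_zero, mul_zero]
      intro u' _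
      simp [hb']
    · simp
  simp only [hx]
  by_cases hg : B.query f b = g
  · simp only [hg, and_true, if_true]
    rw [Finset.sum_div, Finset.mul_sum]
    refine Finset.sum_congr rfl fun x _ => ?_
    split_ifs
    · field_simp
    · simp
  · simp [hg]

open Classical in
theorem sum_abs_unmaskedView {κ R : Type} [Fintype κ] [Fintype R] {n k q m r s : ℕ} (hk : k ≤ n)
    (G : κ → Bits k → Bits q) (Ext : Bits k → Bits r → Bits m) (source : PMF (Bits n × Bits n))
    (B : Bob κ n s R) :
    (∑ f : Memory s, ∑ z : R × κ × Bits q × Positions n k × Bits r, ∑ ω : Bits m,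
      |(unmaskedView hk G Ext source B ((viewEquiv R κ n k q m r).symm (ω, z), f)).toReal
        - (∑ ω' : Bits m, (unmaskedView hk G Ext source B
          ((viewEquiv R κ n k q m r).symm (ω', z), f)).toReal) / Fintype.card (Bits m)|)
      = ∑ b : R, (B.coins b).toReal * ∑ f : Memory s, (∑ A : Positions n k, ∑ z : Bits q,
        extError Ext (fun y => if G (B.query f b) y = z then
          fiberWeight (memoryWeight source B b f) A y else 0)) / Fintype.card (Positions n k) := by
  simp only [Fintype.sum_prod_type]
  rw [Finset.sum_comm]
  refine Finset.sum_congr rfl fun b _ => ?_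
  rw [Finset.mul_sum]
  refine Finset.sum_congr rfl fun f _ => ?_
  set N : ℝ := (Fintype.card (Positions n k) : ℝ) with hN
  have hterm : ∀ g z A u, (∑ ω : Bits m,
      |(unmaskedView hk G Ext source B ((viewEquiv R κ n k q m r).symm (ω, b, g, z, A, u), f)).toReal
        - (∑ ω' : Bits m, (unmaskedView hk G Ext source B
          ((viewEquiv R κ n k q m r).symm (ω', b, g, z, A, u), f)).toReal) / Fintype.card (Bits m)|)
      = if B.query f b = g then (B.coins b).toReal / N * ∑ ω : Bits m,
        |(∑ y, if Ext y u = ω then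
          (if G (B.query f b) y = z then fiberWeight (memoryWeight source B b f) A y else 0)
          else 0) / 2 ^ r - (∑ y, if G (B.query f b) y = z then
            fiberWeight (memoryWeight source B b f) A y else 0) / (2 ^ m * 2 ^ r)| else 0 := by
    intro g z A u
    have hval : ∀ ω, (unmaskedView hk G Ext source B
        ((viewEquiv R κ n k q m r).symm (ω, b, g, z, A, u), f)).toReal = _ := fun ω =>
      toReal_unmaskedView hk G Ext source B b g ω z A u f
    simp only [hval]
    by_cases hg : B.query f b = g
    · simp only [hg, if_true, ← hN]
      rw [Finset.mul_sum]
      refine Finset.sum_congr rfl fun ω _ => ?_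
      have hc : 0 ≤ (B.coins b).toReal / N := by positivity
      rw [← Finset.mul_sum, ← Finset.sum_div]
      have hswap : ∑ ω' : Bits m, ∑ y, (if Ext y u = ω' then
          (if G g y = z then fiberWeight (memoryWeight source B b f) A y else 0) else 0)
          = ∑ y, (if G g y = z then fiberWeight (memoryWeight source B b f) A y else 0) := by
        rw [Finset.sum_comm]
        simp
      rw [hswap, card_bits, mul_div_assoc, ← mul_sub, abs_mul, abs_of_nonneg hc, div_div]
      push_cast
      rw [mul_comm ((2 : ℝ) ^ r)]
    · simp [hg]
  simp only [hterm]
  rw [Finset.sum_eq_single (B.query f b)]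
  · simp only [if_true, extError]
    rw [Finset.sum_comm, ← mul_div_assoc, mul_div_right_comm, Finset.mul_sum]
    refine Finset.sum_congr rfl fun A _ => ?_
    rw [Finset.mul_sum]
    refine Finset.sum_congr rfl fun z _ => ?_
    rw [Finset.mul_sum]
  · intro g _ hg
    simp [Ne.symm hg]
  · simp

theorem condMutualInfo_execution_le {κ R : Type} [Fintype κ] [Fintype R] {n k q m r s : ℕ}
    (hk : k ≤ n) (G : κ → Bits k → Bits q) (Ext : Bits k → Bits r → Bits m)
    (source : PMF (Bits n × Bits n)) (V : PMF (Bits m)) (B : Bob κ n s R) {Δ : ℝ}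
    (hΔ : m ≠ 0 → ∀ b, ∑ f : Memory s, (∑ A : Positions n k, ∑ z : Bits q,
      extError Ext (fun y => if G (B.query f b) y = z then
        fiberWeight (memoryWeight source B b f) A y else 0)) ≤ Δ * Fintype.card (Positions n k)) :
    condMutualInfo (execution hk G Ext source V B) ≤ 3 * m * Δ := by
  classical
  have hmask := condMutualInfo_mask_le V (unmaskedView hk G Ext source B)
    (viewEquiv R κ n k q m r) bxorPerm
  rw [← execution_eq] at hmask
  refine hmask.trans ?_
  have hl : 0 < Real.log 2 := Real.log_pos one_lt_two
  -- For `m = 0` the pad has one value, hence no deviation. For `m ≥ 1` the constant `3` comes from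
  -- `1 / log 2 < 2`.
  rcases Nat.eq_zero_or_pos m with rfl | hm
  · refine le_of_eq ?_
    simp
  · rw [sum_abs_unmaskedView, card_bits]
    push_cast
    rw [Real.log_pow]
    have : Nonempty (Positions n k) := positions_nonempty hk
    have hN : (0 : ℝ) < Fintype.card (Positions n k) := by exact_mod_cast Fintype.card_pos
    have hm1 : (1 : ℝ) ≤ m := by exact_mod_cast hm
    have hcoef : (1 + m * Real.log 2) / Real.log 2 ≤ 3 * m := by
      rw [div_le_iff₀ hl]
      nlinarith [Real.log_two_gt_d9]
    have hΔ' : ∑ b : R, (B.coins b).toReal * ∑ f : Memory s, (∑ A : Positions n k, ∑ z : Bits q,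
        extError Ext (fun y => if G (B.query f b) y = z then
          fiberWeight (memoryWeight source B b f) A y else 0)) / Fintype.card (Positions n k)
        ≤ Δ := by
      rw [← one_mul Δ, ← sum_toReal B.coins, Finset.sum_mul]
      refine Finset.sum_le_sum fun b _ => ?_
      gcongr
      rw [← Finset.sum_div, div_le_iff₀ hN]
      exact hΔ hm.ne' b
    refine mul_le_mul hcoef hΔ' ?_ (by positivity)
    refine Finset.sum_nonneg fun b _ => mul_nonneg ENNReal.toReal_nonneg
      (Finset.sum_nonneg fun f _ => div_nonneg (Finset.sum_nonneg fun A _ =>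
        Finset.sum_nonneg fun z _ => Finset.sum_nonneg fun u _ =>
          Finset.sum_nonneg fun e _ => abs_nonneg _) hN.le)

open Classical in
theorem sum_memory_extError_le {τ c : ℝ} {n k q r m s : ℕ} {Ext : Bits k → Bits r → Bits m}
    {ε α γ ε' : ℝ} (hn : 0 < n) (hε' : 0 < ε')
    (hbound : ∀ (H : Bits k → Bits q) (w : Bits n → ℝ),
      (∀ x, 0 ≤ w x) → (∀ x, w x ≤ (2 : ℝ) ^ (-(α * n))) →
      ∑ A : Positions n k,
        ∑ z : Bits q, extError Ext (fun y => if H y = z then fiberWeight w A y else 0)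
      ≤ Fintype.card (Positions n k) * (2 * (2 : ℝ) ^ ((rate α γ ε' n - α) * n) + (∑ x, w x) *
        (2 * |ε| + 2 * (2 : ℝ) ^ (-(τ * k)) + 2 * (Real.exp (-(c * n)) + Real.exp (-(c * k))))))
    {κ R : Type} (G : κ → Bits k → Bits q) {source : PMF (Bits n × Bits n)}
    (hsource : IsSource (source.map Prod.fst) (α * n)) (B : Bob κ n s R)
    (hs : (s : ℝ) ≤ γ * n) (b : R) :
    ∑ f : Memory s, (∑ A : Positions n k, ∑ z : Bits q,
      extError Ext (fun y => if G (B.query f b) y = z then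
        fiberWeight (memoryWeight source B b f) A y else 0))
    ≤ (2 * ε' + 2 * |ε| + 2 * (2 : ℝ) ^ (-(τ * k))
      + 2 * (Real.exp (-(c * n)) + Real.exp (-(c * k)))) * Fintype.card (Positions n k) := by
  set N : ℝ := (Fintype.card (Positions n k) : ℝ) with hN
  have hN0 : 0 ≤ N := Nat.cast_nonneg _
  have hn' : (0 : ℝ) < n := by exact_mod_cast hn
  refine (Finset.sum_le_sum fun f _ => hbound (G (B.query f b)) (memoryWeight source B b f)
    (memoryWeight_nonneg source B b f) fun x =>
      (memoryWeight_le source B b f x).trans (le_of_isSource hsource x)).trans ?_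
  rw [← Finset.mul_sum, Finset.sum_add_distrib, ← Finset.sum_mul Finset.univ fun f => ∑ x, _,
    sum_memoryWeight, one_mul, Finset.sum_const, Finset.card_univ, nsmul_eq_mul, mul_comm]
  refine mul_le_mul_of_nonneg_right ?_ hN0
  -- The `1` in `rate` absorbs the extra bit in `2 ^ (s + 1)`, and its `log (1 / ε')` leaves `ε'`.
  have hmem : (Fintype.card (Memory s) : ℝ) * (2 : ℝ) ^ ((rate α γ ε' n - α) * n) ≤ ε' := by
    calc _ ≤ (2 : ℝ) ^ (s + 1) * (2 : ℝ) ^ ((rate α γ ε' n - α) * n) := by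
          gcongr
          exact card_memory_le s
      _ ≤ (2 : ℝ) ^ (Real.logb 2 ε') := by
          rw [← Real.rpow_natCast, ← Real.rpow_add two_pos]
          apply Real.rpow_le_rpow_of_exponent_le one_le_two
          have h1 : (rate α γ ε' n - α) * n = -(γ * n) - (1 - Real.logb 2 ε') := by
            rw [rate, one_div, Real.logb_inv]
            field_simp
            ring
          rw [h1]
          push_cast
          linarith
      _ = ε' := Real.rpow_logb two_pos (by norm_num) hε'
  linarith

/-! ### Asymptotics of the parameters. -/

/-- From `k ≤ n` and `n ≥ 1`, `√(l n) < (n + 1) / 2 ≤ n`, so `l ≤ n` and hence `l ≤ √(l n)`. Decay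
in `k` or `n` thus becomes decay in `l`. -/
theorem le_sampleSize {l n : ℕ} (hn : 0 < n) (hk : sampleSize l n ≤ n) :
    l ≤ sampleSize l n ∧ l ≤ n := by
  have hn' : (1 : ℝ) ≤ n := by exact_mod_cast hn
  have hl0 : (0 : ℝ) ≤ l := Nat.cast_nonneg l
  have h1 : 2 * Real.sqrt ((l : ℝ) * n) < n + 1 := by
    have h := Nat.lt_floor_add_one (2 * Real.sqrt ((l : ℝ) * n))
    have h2 : ((sampleSize l n : ℕ) : ℝ) ≤ n := by exact_mod_cast hk
    unfold sampleSize at h2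
    linarith
  have h2 : Real.sqrt ((l : ℝ) * n) ≤ n := by linarith
  have h3 : (l : ℝ) * n ≤ n ^ 2 := (Real.sqrt_le_left (by linarith)).1 h2
  have h4 : (l : ℝ) ≤ n := by
    rw [sq] at h3
    exact le_of_mul_le_mul_right h3 (by linarith)
  have h5 : (l : ℝ) ≤ Real.sqrt ((l : ℝ) * n) := by
    apply Real.le_sqrt_of_sq_le
    rw [sq]
    gcongr
  have h6 : l ≤ sampleSize l n := Nat.le_floor (by linarith)
  exact ⟨h6, h6.trans hk⟩

theorem sampleSize_le {l n d : ℕ} (hl : 2 ≤ l) (hn : n ≤ l ^ d) :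
    (sampleSize l n : ℝ) ≤ (l : ℝ) ^ (d + 2) := by
  have hl' : (2 : ℝ) ≤ l := by exact_mod_cast hl
  have h1 : ((l : ℝ) * n) ≤ l ^ (d + 1) := by
    rw [pow_succ, mul_comm]
    gcongr
    exact_mod_cast hn
  have h2 : (1 : ℝ) ≤ (l : ℝ) ^ (d + 1) := one_le_pow₀ (by linarith)
  calc (sampleSize l n : ℝ) ≤ 2 * Real.sqrt ((l : ℝ) * n) := Nat.floor_le (by positivity)
    _ ≤ l * l ^ (d + 1) := by
        gcongr
        rw [Real.sqrt_le_left (by positivity)]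
        nlinarith
    _ = _ := by ring

theorem negligible_exp_neg {c : ℝ} (hc : 0 < c) : Negligible fun l => Real.exp (-(c * l)) := by
  intro d
  have h : Real.exp (-c) < 1 := by simpa using hc
  refine (tendsto_pow_const_mul_const_pow_of_lt_one d (Real.exp_pos _).le h).congr fun l => ?_
  rw [← Real.exp_nat_mul]
  ring_nf

theorem rate_le_one {α γ ε' : ℝ} (hα : α < 1) (hγ : 0 ≤ γ) (h0 : 0 < ε') (h1 : ε' ≤ 1) (n : ℕ) :
    rate α γ ε' n ≤ 1 := by
  have h2 : 0 ≤ Real.logb 2 (1 / ε') :=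
    Real.logb_nonneg one_lt_two ((one_le_div h0).2 h1)
  have h3 : 0 ≤ (1 + Real.logb 2 (1 / ε')) / n := by positivity
  unfold rate
  linarith

end BSMCommit

/-! ### Assembly of the hiding bound. -/

theorem mainTheorem2
    (α γ δ ζ τ ω ψ : ℝ)
    (hα : 0 < α) (hα1 : α < 1) (hγ : 0 ≤ γ) (hγα : γ < α)
    (hδ : 0 ≤ δ) (hζ : 0 < ζ) (hδζ : δ + ζ < 1 / 2)
    (hτ : 0 < τ) (hω : 2 * BSMCommit.h (δ + ζ) < ω) (hψ : 0 < ψ)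
    (n : ℕ → ℕ)
    (hn : ∃ d : ℕ, ∀ᶠ l : ℕ in Filter.atTop, n l ≤ l ^ d)
    (ε' εE : ℕ → ℝ) (hε'pos : ∀ l, 0 < ε' l)
    (hε' : BSMCommit.Negligible ε') (hεE : BSMCommit.Negligible εE) :
    ∃ lam : ℕ → ℝ, BSMCommit.Negligible lam ∧
      ∀ (l : ℕ) (hk : BSMCommit.sampleSize l (n l) ≤ n l),
        let k := BSMCommit.sampleSize l (n l)
        let ρ := BSMCommit.rate α γ (ε' l) (n l)
        let kE := BSMCommit.extThreshold ρ τ ω k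
        τ ≤ ρ / 3 → ω < ρ - 3 * τ →
        ∀ (κ : Type) [Fintype κ] [Nonempty κ]
          (G : κ → BSMCommit.Bits k → BSMCommit.Bits (BSMCommit.hashLength ω k)),
          BSMCommit.IsTwoUniversal G →
        ∀ (r : ℕ)
          (Ext : BSMCommit.Bits k → BSMCommit.Bits r → BSMCommit.Bits (BSMCommit.msgLength ψ kE)),
          BSMCommit.IsStrongExtractor Ext kE (εE l) →
        BSMCommit.IsHiding hk G Ext α γ δ (lam l) := by
  classical
  have hl2 : 0 < Real.log 2 := Real.log_pos one_lt_two
  have hω0 : 0 < ω := by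
    have : 0 ≤ BSMCommit.h (δ + ζ) :=
      div_nonneg (Real.binEntropy_nonneg (by linarith) (by linarith)) hl2.le
    linarith
  obtain ⟨c, hc, hbound⟩ := BSMCommit.exists_sum_extError_bound hτ
  set c' := min c (τ * Real.log 2) with hc'
  have hc'0 : 0 < c' := lt_min hc (by positivity)
  -- The `6` collects three exponential errors of weight `2`: the slack `2 ^ (-τ k)` and the two
  -- sampling terms, all at rate `c'`.
  set Δ : ℕ → ℝ := fun l => 2 * ε' l + 2 * |εE l| + 6 * Real.exp (-(c' * l)) with hΔ
  have hΔ0 : ∀ l, 0 ≤ Δ l := fun l => by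
    have := hε'pos l
    positivity
  have hΔneg : BSMCommit.Negligible Δ :=
    ((hε'.const_mul 2).add ((hεE.trans_abs_le (g := fun l => |εE l|)
      fun l => (abs_abs _).le).const_mul 2)).add ((BSMCommit.negligible_exp_neg hc'0).const_mul 6)
  -- The message length is at most `max 1 ρ * k`. The rate may exceed `1` while `ε' l > 1`, but
  -- eventually the maximum is `1`.
  refine ⟨fun l => 3 * (max 1 (BSMCommit.rate α γ (ε' l) (n l)) *
    BSMCommit.sampleSize l (n l)) * Δ l, ?_, ?_⟩
  · obtain ⟨d, hd⟩ := hn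
    have hle1 : ∀ᶠ l in Filter.atTop, ε' l ≤ 1 := by
      have h := hε' 0
      simp only [pow_zero, one_mul] at h
      exact h.eventually (eventually_le_nhds zero_lt_one)
    refine Asymptotics.SuperpolynomialDecay.trans_eventually_abs_le
      ((hΔneg.const_mul 3).param_pow_mul (d + 2)) ?_
    filter_upwards [hd, hle1, Filter.eventually_ge_atTop 2] with l h1 h2 h3
    have h4 := BSMCommit.sampleSize_le h3 h1
    have h5 : 0 ≤ 3 * Δ l := mul_nonneg zero_le_three (hΔ0 l)
    simp only [Function.comp_apply, Pi.mul_apply, Pi.pow_apply]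
    rw [max_eq_left (BSMCommit.rate_le_one hα1 hγ (hε'pos l) h2 (n l)), one_mul,
      abs_of_nonneg (mul_nonneg (by positivity) (hΔ0 l)), abs_of_nonneg (by positivity)]
    nlinarith [mul_le_mul_of_nonneg_right h4 h5]
  · intro l hk k ρ kE hτρ hωρ κ _ _ G hG r Ext hExt source hsource _ V R _ s B hs
    have hk0 : (0 : ℝ) ≤ k := Nat.cast_nonneg k
    have hkE0 : 0 ≤ kE := mul_nonneg (by linarith) hk0
    have hkEle : kE ≤ max 1 ρ * k := by
      change (ρ - 3 * τ - ω) * k ≤ _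
      gcongr
      linarith [le_max_right 1 ρ]
    have hm : (BSMCommit.msgLength ψ kE : ℝ) ≤ max 1 ρ * k := by
      rcases le_or_gt 0 ((1 - ψ) * kE) with h | h
      · refine (Nat.floor_le h).trans (le_trans ?_ hkEle)
        nlinarith [mul_nonneg hψ.le hkE0]
      · rw [BSMCommit.msgLength, Nat.floor_of_nonpos h.le]
        push_cast
        positivity
    have hmain : BSMCommit.condMutualInfo (BSMCommit.execution hk G Ext source V B)
        ≤ 3 * (BSMCommit.msgLength ψ kE : ℝ) * Δ l := by
      refine BSMCommit.condMutualInfo_execution_le hk G Ext source V B fun hm0 b => ?_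
      -- `n l = 0` would force `k = 0` and an empty message, excluded by `hm0`.
      have hn0 : 0 < n l := by
        by_contra h
        have hk1 : k = 0 := by omega
        refine hm0 ?_
        change ⌊(1 - ψ) * ((ρ - 3 * τ - ω) * (k : ℝ))⌋₊ = 0
        rw [hk1]
        simp
      have hq : (BSMCommit.hashLength ω k : ℝ) + kE ≤ (ρ - 3 * τ) * k := by
        have h1 : (BSMCommit.hashLength ω k : ℝ) ≤ ω * k := Nat.floor_le (by positivity)
        change _ + (ρ - 3 * τ - ω) * k ≤ _
        linarith
      refine (BSMCommit.sum_memory_extError_le hn0 (hε'pos l) (fun H w hw hw' =>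
        hbound (n l) k _ r _ Ext kE (εE l) α ρ H w hn0 hExt hw hw' hq) G hsource B hs b).trans ?_
      gcongr
      obtain ⟨hlk, hln⟩ := BSMCommit.le_sampleSize hn0 hk
      have hlk' : (l : ℝ) ≤ k := by exact_mod_cast hlk
      have hln' : (l : ℝ) ≤ n l := by exact_mod_cast hln
      have hl0 : (0 : ℝ) ≤ l := Nat.cast_nonneg l
      have e1 : Real.exp (-(c * (n l : ℝ))) ≤ Real.exp (-(c' * l)) := by
        gcongr
        exact min_le_left _ _
      have e2 : Real.exp (-(c * (k : ℝ))) ≤ Real.exp (-(c' * l)) := by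
        gcongr
        exact min_le_left _ _
      have e3 : (2 : ℝ) ^ (-(τ * (k : ℝ))) ≤ Real.exp (-(c' * l)) := by
        rw [Real.rpow_def_of_pos two_pos, show Real.log 2 * -(τ * (k : ℝ))
          = -(τ * Real.log 2 * k) by ring]
        gcongr
        exact min_le_right _ _
      simp only [hΔ]
      linarith
    refine hmain.trans ?_
    have := hΔ0 l
    dsimp only
    gcongr
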